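/- Let $(M,\mathcal A)$ be a (smooth, real) supermanifold of dimension $m|n$: $M$ is a smooth $m$-manifold and $\mathcal A$ is a sheaf on $M$ of $\mathbb Z_2$-graded commutative, associative, unital $\mathbb R$-algebras that is locally isomorphic, as a sheaf of superalgebras, to $C^\infty_M\otimes\Lambda(\mathbb R^n)$. Let $\operatorname{Der}\mathcal A$ be the sheaf of graded derivations of $\mathcal A$ (graded vector fields), a sheaf of left $\mathcal A$-modules, and let $\nabla$ be a graded linear connection on $(M,\mathcal A)$, i.e. a morphism of sheaves of graded vector spaces $\operatorname{Der}\mathcal A\otimes_{\mathbb R}\operatorname{Der}\mathcal A\to\operatorname{Der}\mathcal A$, $D\otimes E\mapsto\nabla_DE$, such that $$\nabla_{fD}E=f\,\nabla_DE,\qquad \nabla_D(fE)=D(f)\,E+(-1)^{|D||f|}f\,\nabla_DE .$$ For a graded vector field $D$ on an open set $U$, let $\operatorname{ad}_D(E)=[D,E]$ be the graded commutator. Then $\nabla_D-\operatorname{ad}_D$ is, for homogeneous $D$, an endomorphism of parity $|D|$ of the sheaf of $\mathcal A|_U$-modules $\operatorname{Der}\mathcal A|_U$, and for every $D$ over $U$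 the operator $\nabla_D-\operatorname{ad}_D$ has a well-defined supertrace $$\operatorname{div}_\nabla(D)=\operatorname{sTr}(\nabla_D-\operatorname{ad}_D)\in\mathcal A(U),$$ where $\operatorname{sTr}(T)$ is the unique section of $\mathcal A$ over $U$ that equals $\sum_k(-1)^{|e_k|}c_k^k$ in every local homogeneous frame $(e_k)$ of $\operatorname{Der}\mathcal A$ over an open subset of $U$, if $T(e_k)=\sum_jc_k^j\,e_j$. Moreover $\operatorname{div}_\nabla\colon\operatorname{Der}\mathcal A\to\mathcal A$ is a divergence operator, i.e. an even morphism of sheaves of real vector spaces with $$\operatorname{div}_\nabla(fD)=f\operatorname{div}_\nabla(D)+(-1)^{|f||D|}D(f)$$ for all homogeneous sections $f$ of $\mathcal A$ and homogeneous graded vector fields $D$ over any open set. -/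

import Mathlib

open CategoryTheory TopologicalSpace Opposite
open scoped Manifold ContDiff

universe u

namespace Supergeometry

/-- The sign `(-1)^{|a||b|}` for parities `i = |a|` and `j = |b|`. -/
def koszul (i j : ZMod 2) : ℝ := (-1) ^ (i.val * j.val)

/-- A sheaf of `ℤ/2`-graded commutative, associative, unital real algebras on `M`. -/
structure SuperalgebraSheaf (M : Type u) [TopologicalSpace M] where
  toSheaf : TopCat.Sheaf (AlgCat.{u} ℝ) (TopCat.of M)
  /-- `deg U i` is the space of sections of parity `i` over `U`. -/
  deg : ∀ U : Opens M, ZMod 2 → Submodule ℝ (toSheaf.presheaf.obj (op U))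
  graded : ∀ U : Opens M, GradedAlgebra (deg U)
  map_mem : ∀ (U V : Opens M) (h : V ≤ U) (i : ZMod 2) (f : toSheaf.presheaf.obj (op U)),
    f ∈ deg U i → (toSheaf.presheaf.map (homOfLE h).op).hom f ∈ deg V i
  mul_comm : ∀ (U : Opens M) (i j : ZMod 2) (f g : toSheaf.presheaf.obj (op U)),
    f ∈ deg U i → g ∈ deg U j → f * g = koszul i j • (g * f)

namespace SuperalgebraSheaf

variable {M : Type u} [TopologicalSpace M] (A : SuperalgebraSheaf M)

/-- The algebra of sections over `U`. -/
abbrev Sec (U : Opens M) : Type u := A.toSheaf.presheaf.obj (op U)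

instance (U : Opens M) : GradedAlgebra (A.deg U) := A.graded U

/-- Restriction of sections. -/
def res {U V : Opens M} (h : V ≤ U) : A.Sec U →ₐ[ℝ] A.Sec V :=
  (A.toSheaf.presheaf.map (homOfLE h).op).hom

theorem res_mem {U V : Opens M} (h : V ≤ U) {i : ZMod 2} {f : A.Sec U} (hf : f ∈ A.deg U i) :
    A.res h f ∈ A.deg V i :=
  A.map_mem U V h i f hf

theorem res_self {U : Opens M} (h : U ≤ U) (f : A.Sec U) : A.res h f = f := by
  have : (homOfLE h).op = 𝟙 (op U) := rfl
  simp only [res, this]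
  rw [A.toSheaf.presheaf.map_id]
  rfl

theorem res_res {U V W : Opens M} (h : V ≤ U) (h' : W ≤ V) (f : A.Sec U) :
    A.res h' (A.res h f) = A.res (h'.trans h) f := by
  have : (homOfLE (h'.trans h)).op = (homOfLE h).op ≫ (homOfLE h').op := rfl
  simp only [res, this]
  rw [A.toSheaf.presheaf.map_comp]
  rfl

/-- The component of parity `i` of a section. -/
def proj (U : Opens M) (i : ZMod 2) : A.Sec U →ₗ[ℝ] A.Sec U :=
  (A.deg U i).subtype ∘ₗ DirectSum.component ℝ (ZMod 2) (fun j => A.deg U j) i ∘ₗ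
    (DirectSum.decomposeLinearEquiv (A.deg U)).toLinearMap

theorem proj_mem (U : Opens M) (i : ZMod 2) (f : A.Sec U) : A.proj U i f ∈ A.deg U i :=
  Submodule.coe_mem _

theorem proj_of_mem {U : Opens M} {i : ZMod 2} {f : A.Sec U} (hf : f ∈ A.deg U i) (j : ZMod 2) :
    A.proj U j f = if j = i then f else 0 := by
  by_cases h : j = i
  · subst h
    rw [if_pos rfl]
    exact DirectSum.decompose_of_mem_same _ hf
  · rw [if_neg h]
    exact DirectSum.decompose_of_mem_ne _ hf (Ne.symm h)

theorem section_induction {U : Opens M} {p : A.Sec U → Prop} (h0 : p 0)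
    (hom : ∀ i, ∀ f ∈ A.deg U i, p f) (add : ∀ f g, p f → p g → p (f + g)) (f : A.Sec U) : p f :=
  DirectSum.Decomposition.inductionOn (A.deg U) h0 (fun m => hom _ _ m.2) add f

/-- Families of linear operators on the sections over the open subsets of `U`. -/
structure LocalOp (U : Opens M) where
  op : ∀ V : Opens M, V ≤ U → (A.Sec V →ₗ[ℝ] A.Sec V)

instance (U : Opens M) :
    CoeFun (A.LocalOp U) fun _ => ∀ V : Opens M, V ≤ U → (A.Sec V →ₗ[ℝ] A.Sec V) :=
  ⟨LocalOp.op⟩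

variable {A} in
theorem LocalOp.ext {U : Opens M} {D E : A.LocalOp U} (h : ∀ V hV f, D V hV f = E V hV f) :
    D = E := by
  cases D
  cases E
  congr
  funext V hV
  exact LinearMap.ext (h V hV)

instance (U : Opens M) : Zero (A.LocalOp U) := ⟨⟨fun _ _ => 0⟩⟩

instance (U : Opens M) : Add (A.LocalOp U) := ⟨fun D E => ⟨fun V hV => D V hV + E V hV⟩⟩

instance (U : Opens M) : Neg (A.LocalOp U) := ⟨fun D => ⟨fun V hV => -D V hV⟩⟩

instance (U : Opens M) : SMul ℝ (A.LocalOp U) := ⟨fun r D => ⟨fun V hV => r • D V hV⟩⟩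

instance (U : Opens M) : AddCommGroup (A.LocalOp U) where
  add_assoc D E F := LocalOp.ext fun V hV f => add_assoc (D V hV f) (E V hV f) (F V hV f)
  zero_add D := LocalOp.ext fun V hV f => zero_add (D V hV f)
  add_zero D := LocalOp.ext fun V hV f => add_zero (D V hV f)
  neg_add_cancel D := LocalOp.ext fun V hV f => neg_add_cancel (D V hV f)
  add_comm D E := LocalOp.ext fun V hV f => add_comm (D V hV f) (E V hV f)
  nsmul := nsmulRec
  zsmul := zsmulRec

instance (U : Opens M) : Module ℝ (A.LocalOp U) where
  one_smul D := LocalOp.ext fun V hV f => one_smul ℝ (D V hV f)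
  mul_smul r r' D := LocalOp.ext fun V hV f => mul_smul r r' (D V hV f)
  smul_zero r := LocalOp.ext fun _ _ _ => smul_zero r
  smul_add r D E := LocalOp.ext fun V hV f => smul_add r (D V hV f) (E V hV f)
  add_smul r r' D := LocalOp.ext fun V hV f => add_smul r r' (D V hV f)
  zero_smul D := LocalOp.ext fun V hV f => zero_smul ℝ (D V hV f)

/-- Left multiplication of operators by sections: `(f D)(g) = f D(g)`. -/
instance (U : Opens M) : Module (A.Sec U) (A.LocalOp U) where
  smul f D := ⟨fun V hV => LinearMap.mulLeft ℝ (A.res hV f) ∘ₗ D V hV⟩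
  one_smul D := LocalOp.ext fun V hV g => by
    change A.res hV 1 * D V hV g = D V hV g
    rw [map_one, one_mul]
  mul_smul f f' D := LocalOp.ext fun V hV g => by
    change A.res hV (f * f') * D V hV g = A.res hV f * (A.res hV f' * D V hV g)
    rw [map_mul, mul_assoc]
  smul_zero f := LocalOp.ext fun V hV g => mul_zero (A.res hV f)
  smul_add f D E := LocalOp.ext fun V hV g => mul_add (A.res hV f) (D V hV g) (E V hV g)
  add_smul f f' D := LocalOp.ext fun V hV g => by
    change A.res hV (f + f') * D V hV g = A.res hV f * D V hV g + A.res hV f' * D V hV g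
    rw [map_add, add_mul]
  zero_smul D := LocalOp.ext fun V hV g => by
    change A.res hV 0 * D V hV g = 0
    rw [map_zero, zero_mul]

theorem smul_apply {U : Opens M} (f : A.Sec U) (D : A.LocalOp U) (V : Opens M) (hV : V ≤ U)
    (g : A.Sec V) : (f • D) V hV g = A.res hV f * D V hV g := rfl

theorem real_smul_apply {U : Opens M} (r : ℝ) (D : A.LocalOp U) (V : Opens M) (hV : V ≤ U)
    (g : A.Sec V) : (r • D) V hV g = r • D V hV g := rfl

theorem add_apply {U : Opens M} (D E : A.LocalOp U) (V : Opens M) (hV : V ≤ U)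
    (g : A.Sec V) : (D + E) V hV g = D V hV g + E V hV g := rfl

theorem sub_apply {U : Opens M} (D E : A.LocalOp U) (V : Opens M) (hV : V ≤ U)
    (g : A.Sec V) : (D - E) V hV g = D V hV g - E V hV g := by
  rw [sub_eq_add_neg, sub_eq_add_neg]
  rfl

theorem zero_apply {U : Opens M} (V : Opens M) (hV : V ≤ U)
    (g : A.Sec V) : (0 : A.LocalOp U) V hV g = 0 := rfl

instance (U : Opens M) : IsScalarTower ℝ (A.Sec U) (A.LocalOp U) where
  smul_assoc r f D := LocalOp.ext fun V hV g => by
    rw [smul_apply, real_smul_apply, smul_apply, map_smul, smul_mul_assoc]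

/-- Derivations of parity `i` of the sheaf of superalgebras `A` restricted to `U`: morphisms of
sheaves of vector spaces, of parity `i`, satisfying the graded Leibniz rule
`D(fg) = D(f) g + (-1)^{|D||f|} f D(g)`. -/
def homDer (U : Opens M) (i : ZMod 2) : Submodule ℝ (A.LocalOp U) where
  carrier := {D |
    (∀ (V W : Opens M) (hV : V ≤ U) (hW : W ≤ V) (f : A.Sec V),
      A.res hW (D V hV f) = D W (hW.trans hV) (A.res hW f)) ∧
    (∀ (V : Opens M) (hV : V ≤ U) (j : ZMod 2) (f : A.Sec V), f ∈ A.deg V j →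
      D V hV f ∈ A.deg V (i + j)) ∧
    (∀ (V : Opens M) (hV : V ≤ U) (j : ZMod 2) (f g : A.Sec V), f ∈ A.deg V j →
      D V hV (f * g) = D V hV f * g + koszul i j • (f * D V hV g))}
  zero_mem' := by
    refine ⟨fun V W hV hW f => ?_, fun V hV j f hf => ?_, fun V hV j f g hf => ?_⟩
    · rw [zero_apply, zero_apply, map_zero]
    · rw [zero_apply]; exact zero_mem _
    · simp only [zero_apply, zero_mul, mul_zero, smul_zero, add_zero]
  add_mem' := by
    rintro D E ⟨hD1, hD2, hD3⟩ ⟨hE1, hE2, hE3⟩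
    refine ⟨fun V W hV hW f => ?_, fun V hV j f hf => ?_, fun V hV j f g hf => ?_⟩
    · rw [add_apply, add_apply, map_add, hD1, hE1]
    · rw [add_apply]; exact add_mem (hD2 V hV j f hf) (hE2 V hV j f hf)
    · simp only [add_apply, hD3 V hV j f g hf, hE3 V hV j f g hf, add_mul, mul_add, smul_add]
      abel
  smul_mem' := by
    rintro r D ⟨hD1, hD2, hD3⟩
    refine ⟨fun V W hV hW f => ?_, fun V hV j f hf => ?_, fun V hV j f g hf => ?_⟩
    · rw [real_smul_apply, real_smul_apply, map_smul, hD1]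
    · rw [real_smul_apply]; exact Submodule.smul_mem _ r (hD2 V hV j f hf)
    · simp only [real_smul_apply, hD3 V hV j f g hf, smul_add, smul_mul_assoc, mul_smul_comm]
      rw [smul_comm]

theorem koszul_add_left (i j k : ZMod 2) : koszul (i + j) k = koszul i k * koszul j k := by
  have h : ∀ i j k : ZMod 2, ((i + j).val * k.val) % 2 = (i.val * k.val + j.val * k.val) % 2 := by
    decide
  unfold koszul
  rw [← pow_add, neg_one_pow_eq_pow_mod_two, h, ← neg_one_pow_eq_pow_mod_two]

theorem koszul_comm (i j : ZMod 2) : koszul i j = koszul j i := by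
  unfold koszul; rw [Nat.mul_comm]

theorem koszul_add_right (i j k : ZMod 2) : koszul k (i + j) = koszul k i * koszul k j := by
  rw [koszul_comm, koszul_add_left, koszul_comm i, koszul_comm j]

theorem koszul_mul_self (i j : ZMod 2) : koszul i j * koszul i j = 1 := by
  unfold koszul
  rw [← mul_pow]
  norm_num

theorem smul_mem_homDer {U : Opens M} {i j : ZMod 2} {f : A.Sec U} (hf : f ∈ A.deg U j)
    {D : A.LocalOp U} (hD : D ∈ A.homDer U i) : f • D ∈ A.homDer U (j + i) := by
  obtain ⟨hD1, hD2, hD3⟩ := hD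
  refine ⟨fun V W hV hW g => ?_, fun V hV k g hg => ?_, fun V hV k g g' hg => ?_⟩
  · rw [smul_apply, smul_apply, map_mul, hD1, res_res]
  · rw [smul_apply, add_assoc]
    exact SetLike.mul_mem_graded (A.res_mem hV hf) (hD2 V hV k g hg)
  · rw [smul_apply, smul_apply, smul_apply, hD3 V hV k g g' hg, mul_add, mul_smul_comm,
      ← mul_assoc, ← mul_assoc, A.mul_comm V j k _ _ (A.res_mem hV hf) hg, smul_mul_assoc,
      smul_smul, koszul_add_left, _root_.mul_comm (koszul i k),
      mul_assoc g]

/-- The module of graded vector fields over `U`, i.e. the sections over `U` of the sheaf `Der A`: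
sums of homogeneous derivations of `A` restricted to `U`, with left multiplication by sections
of `A` over `U`. -/
def Der (U : Opens M) : Submodule (A.Sec U) (A.LocalOp U) where
  carrier := {D | D ∈ ⨆ i, A.homDer U i}
  zero_mem' := zero_mem (⨆ i, A.homDer U i)
  add_mem' := fun h h' => (⨆ i, A.homDer U i).add_mem h h'
  smul_mem' := by
    intro f D hD
    refine Submodule.iSup_induction (A.homDer U) (motive := fun D => f • D ∈ ⨆ i, A.homDer U i)
      hD (fun i D hD => ?_) (by rw [smul_zero]; exact zero_mem _)
      (fun D E hD hE => by rw [smul_add]; exact add_mem hD hE)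
    refine A.section_induction (p := fun f => f • D ∈ ⨆ i, A.homDer U i)
      (by rw [zero_smul]; exact zero_mem _) (fun j f hf => ?_)
      (fun f g hf hg => by rw [add_smul]; exact add_mem hf hg) f
    exact Submodule.mem_iSup_of_mem (j + i) (A.smul_mem_homDer hf hD)

/-- The graded vector fields of parity `i`. -/
def derDeg (U : Opens M) (i : ZMod 2) : Submodule ℝ (A.Der U) :=
  (A.homDer U i).comap ((A.Der U).subtype.restrictScalars ℝ)

/-- The action `D(f)` of a graded vector field over `U` on a section over `U`. -/
def act {U : Opens M} (D : A.Der U) (f : A.Sec U) : A.Sec U := D.1 U le_rfl f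

/-- Restriction of families of operators to a smaller open set. -/
def resOp {U V : Opens M} (h : V ≤ U) : A.LocalOp U →ₗ[ℝ] A.LocalOp V where
  toFun D := ⟨fun W hW => D W (hW.trans h)⟩
  map_add' _ _ := rfl
  map_smul' _ _ := rfl

theorem resOp_mem_homDer {U V : Opens M} (h : V ≤ U) {i : ZMod 2} {D : A.LocalOp U}
    (hD : D ∈ A.homDer U i) : A.resOp h D ∈ A.homDer V i :=
  ⟨fun W W' hW hW' f => hD.1 W W' (hW.trans h) hW' f,
    fun W hW j f hf => hD.2.1 W (hW.trans h) j f hf,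
    fun W hW j f g hf => hD.2.2 W (hW.trans h) j f g hf⟩

theorem resOp_mem {U V : Opens M} (h : V ≤ U) {D : A.LocalOp U} (hD : D ∈ A.Der U) :
    A.resOp h D ∈ A.Der V :=
  Submodule.iSup_induction (A.homDer U) (motive := fun D => A.resOp h D ∈ ⨆ i, A.homDer V i)
    (show D ∈ ⨆ i, A.homDer U i from hD) (fun i _ hD => Submodule.mem_iSup_of_mem i (A.resOp_mem_homDer h hD))
    (by rw [map_zero]; exact zero_mem _)
    (fun D E hD hE => by rw [map_add]; exact add_mem hD hE)

/-- Restriction of graded vector fields. -/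
def resDer {U V : Opens M} (h : V ≤ U) : A.Der U →ₗ[ℝ] A.Der V where
  toFun D := ⟨A.resOp h D.1, A.resOp_mem h D.2⟩
  map_add' _ _ := rfl
  map_smul' _ _ := rfl

/-- The homogeneous component of parity `i` of a family of operators. -/
def opComp (U : Opens M) (i : ZMod 2) : A.LocalOp U →ₗ[ℝ] A.LocalOp U where
  toFun D := ⟨fun V hV => ∑ j, A.proj V (i + j) ∘ₗ D V hV ∘ₗ A.proj V j⟩
  map_add' D E := LocalOp.ext fun V hV f => by
    simp only [add_apply, LinearMap.sum_apply, LinearMap.comp_apply, map_add,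
      Finset.sum_add_distrib]
  map_smul' r D := LocalOp.ext fun V hV f => by
    simp only [real_smul_apply, LinearMap.sum_apply, LinearMap.comp_apply, map_smul,
      Finset.smul_sum, RingHom.id_apply]

/-- Composition of families of operators. -/
def opMul {U : Opens M} (D E : A.LocalOp U) : A.LocalOp U := ⟨fun V hV => D V hV ∘ₗ E V hV⟩

/-- The graded commutator: `[D, E] = D E - (-1)^{|D||E|} E D` on homogeneous operators, extended
bilinearly. -/
def opBracket {U : Opens M} (D E : A.LocalOp U) : A.LocalOp U :=
  ∑ i, ∑ j, (A.opMul (A.opComp U i D) (A.opComp U j E) -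
    koszul i j • A.opMul (A.opComp U j E) (A.opComp U i D))

theorem opBracket_add_left {U : Opens M} (D D' E : A.LocalOp U) :
    A.opBracket (D + D') E = A.opBracket D E + A.opBracket D' E := by
  simp only [opBracket, ← Finset.sum_add_distrib]
  refine Finset.sum_congr rfl fun i _ => Finset.sum_congr rfl fun j _ => LocalOp.ext fun V hV f => ?_
  simp only [map_add, opMul, add_apply, sub_apply, real_smul_apply, LinearMap.comp_apply, smul_add]
  abel

theorem opBracket_add_right {U : Opens M} (D E E' : A.LocalOp U) :
    A.opBracket D (E + E') = A.opBracket D E + A.opBracket D E' := by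
  simp only [opBracket, ← Finset.sum_add_distrib]
  refine Finset.sum_congr rfl fun i _ => Finset.sum_congr rfl fun j _ => LocalOp.ext fun V hV f => ?_
  simp only [map_add, opMul, add_apply, sub_apply, real_smul_apply, LinearMap.comp_apply, smul_add]
  abel

theorem opBracket_smul_right {U : Opens M} (r : ℝ) (D E : A.LocalOp U) :
    A.opBracket D (r • E) = r • A.opBracket D E := by
  simp only [opBracket, Finset.smul_sum]
  refine Finset.sum_congr rfl fun i _ => Finset.sum_congr rfl fun j _ => LocalOp.ext fun V hV f => ?_
  simp only [map_smul, opMul, sub_apply, real_smul_apply, LinearMap.comp_apply, smul_sub]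
  rw [smul_comm]

theorem sum_proj {U : Opens M} (f : A.Sec U) : ∑ i, A.proj U i f = f := by
  refine A.section_induction (p := fun f => ∑ i, A.proj U i f = f) (by simp) (fun i f hf => ?_)
    (fun f g hf hg => ?_) f
  · simp [A.proj_of_mem hf]
  · simp only [map_add, Finset.sum_add_distrib, hf, hg]

theorem opComp_of_mem {U : Opens M} {i : ZMod 2} {D : A.LocalOp U} (hD : D ∈ A.homDer U i)
    (k : ZMod 2) : A.opComp U k D = if k = i then D else 0 := by
  refine LocalOp.ext fun V hV f => ?_
  have h1 : A.opComp U k D V hV f = ∑ j, if k = i then D V hV (A.proj V j f) else 0 := by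
    change (∑ j, A.proj V (k + j) ∘ₗ D V hV ∘ₗ A.proj V j) f = _
    rw [LinearMap.sum_apply]
    refine Finset.sum_congr rfl fun j _ => ?_
    rw [LinearMap.comp_apply, LinearMap.comp_apply,
      A.proj_of_mem (hD.2.1 V hV j _ (A.proj_mem V j f))]
    simp only [add_left_inj]
  rw [h1]
  by_cases h : k = i
  · simp only [if_pos h]
    rw [← map_sum, sum_proj]
  · simp only [if_neg h, Finset.sum_const_zero, zero_apply]

theorem opBracket_of_mem {U : Opens M} {i j : ZMod 2} {D E : A.LocalOp U}
    (hD : D ∈ A.homDer U i) (hE : E ∈ A.homDer U j) :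
    A.opBracket D E = A.opMul D E - koszul i j • A.opMul E D := by
  have hz : ∀ F : A.LocalOp U, A.opMul F 0 = 0 := fun F =>
    LocalOp.ext fun V hV f => map_zero (F V hV)
  have hz' : ∀ F : A.LocalOp U, A.opMul 0 F = 0 := fun F => rfl
  unfold opBracket
  rw [Finset.sum_eq_single i, Finset.sum_eq_single j]
  · rw [A.opComp_of_mem hD, A.opComp_of_mem hE, if_pos rfl, if_pos rfl]
  · intro k _ hk
    rw [A.opComp_of_mem hE, if_neg hk, hz, hz', smul_zero, sub_zero]
  · intro h; exact absurd (Finset.mem_univ _) h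
  · intro k _ hk
    refine Finset.sum_eq_zero fun l _ => ?_
    rw [A.opComp_of_mem hD, if_neg hk, hz, hz', smul_zero, sub_zero]
  · intro h; exact absurd (Finset.mem_univ _) h

theorem opBracket_mem_homDer {U : Opens M} {i j : ZMod 2} {D E : A.LocalOp U}
    (hD : D ∈ A.homDer U i) (hE : E ∈ A.homDer U j) :
    A.opBracket D E ∈ A.homDer U (i + j) := by
  rw [A.opBracket_of_mem hD hE]
  obtain ⟨hD1, hD2, hD3⟩ := hD
  obtain ⟨hE1, hE2, hE3⟩ := hE
  refine ⟨fun V W hV hW f => ?_, fun V hV k f hf => ?_, fun V hV k f g hf => ?_⟩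
  · simp only [opMul, sub_apply, real_smul_apply, LinearMap.comp_apply, map_sub, map_smul, hD1, hE1]
  · simp only [opMul, sub_apply, real_smul_apply, LinearMap.comp_apply]
    refine sub_mem ?_ (Submodule.smul_mem _ _ ?_)
    · rw [add_assoc]; exact hD2 V hV _ _ (hE2 V hV _ _ hf)
    · rw [add_comm i j, add_assoc]; exact hE2 V hV _ _ (hD2 V hV _ _ hf)
  · simp only [opMul, sub_apply, real_smul_apply, LinearMap.comp_apply]
    rw [hE3 V hV k f g hf, hD3 V hV k f g hf]
    simp only [map_add, map_smul]
    rw [hD3 V hV _ _ g (hE2 V hV k f hf), hD3 V hV k f _ hf,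
      hE3 V hV _ _ g (hD2 V hV k f hf), hE3 V hV k f _ hf]
    have h1 := koszul_mul_self i j
    simp only [koszul_add_left, koszul_add_right, koszul_comm j i, smul_add, smul_sub, sub_mul,
      mul_sub, smul_smul, smul_mul_assoc, mul_smul_comm]
    have e1 : koszul i j * (koszul i j * koszul j k) = koszul j k := by
      rw [← mul_assoc, h1, one_mul]
    have e2 : koszul i j * (koszul i k * koszul j k) = koszul i k * koszul j k * koszul i j := by
      ring
    have e3 : koszul j k * koszul i k = koszul i k * koszul j k := by ring
    simp only [e1, e2, e3]
    abel

theorem opBracket_mem {U : Opens M} {D E : A.LocalOp U} (hD : D ∈ A.Der U) (hE : E ∈ A.Der U) :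
    A.opBracket D E ∈ A.Der U := by
  refine Submodule.iSup_induction (A.homDer U)
    (motive := fun D => A.opBracket D E ∈ ⨆ i, A.homDer U i)
    (show D ∈ ⨆ i, A.homDer U i from hD) (fun i D hD => ?_) ?_
    (fun D D' h h' => by rw [opBracket_add_left]; exact add_mem h h')
  · refine Submodule.iSup_induction (A.homDer U)
      (motive := fun E => A.opBracket D E ∈ ⨆ i, A.homDer U i)
      (show E ∈ ⨆ i, A.homDer U i from hE)
      (fun j E hE => Submodule.mem_iSup_of_mem (i + j) (A.opBracket_mem_homDer hD hE)) ?_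
      (fun E E' h h' => by rw [opBracket_add_right]; exact add_mem h h')
    have : A.opBracket D 0 = 0 := by
      rw [← add_eq_left (a := A.opBracket D 0), ← opBracket_add_right, add_zero]
    rw [this]; exact zero_mem _
  · have : A.opBracket 0 E = 0 := by
      rw [← add_eq_left (a := A.opBracket 0 E), ← opBracket_add_left, add_zero]
    rw [this]; exact zero_mem _

/-- `ad_D : E ↦ [D, E]`, the graded commutator with a graded vector field `D` over `U`. -/
def ad {U : Opens M} (D : A.Der U) : A.Der U →ₗ[ℝ] A.Der U where
  toFun E := ⟨A.opBracket D.1 E.1, A.opBracket_mem D.2 E.2⟩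
  map_add' E E' := Subtype.ext (A.opBracket_add_right D.1 E.1 E'.1)
  map_smul' r E := Subtype.ext (A.opBracket_smul_right r D.1 E.1)

/-- Families of linear operators on the graded vector fields over the open subsets of `U`. -/
abbrev DerOp (U : Opens M) : Type u := ∀ V : Opens M, V ≤ U → (A.Der V →ₗ[ℝ] A.Der V)

variable {A} in
/-- `T` is an endomorphism of parity `i` of the sheaf of `A`-modules `Der A` over `U`. -/
structure IsModuleEnd {U : Opens M} (i : ZMod 2) (T : A.DerOp U) : Prop where
  res : ∀ (V W : Opens M) (hV : V ≤ U) (hW : W ≤ V) (E : A.Der V),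
    A.resDer hW (T V hV E) = T W (hW.trans hV) (A.resDer hW E)
  mem : ∀ (V : Opens M) (hV : V ≤ U) (j : ZMod 2) (E : A.Der V), E ∈ A.derDeg V j →
    T V hV E ∈ A.derDeg V (i + j)
  smul : ∀ (V : Opens M) (hV : V ≤ U) (j : ZMod 2) (f : A.Sec V) (E : A.Der V), f ∈ A.deg V j →
    T V hV (f • E) = koszul i j • (f • T V hV E)

/-- The parity of the members of a frame with even members indexed by `Fin p` and odd members
indexed by `Fin q`. -/
def frameParity {p q : ℕ} : Fin p ⊕ Fin q → ZMod 2 := Sum.elim (fun _ => 0) (fun _ => 1)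

/-- A homogeneous frame of the sheaf of left `A`-modules `Der A` over `V`. -/
structure IsFrame {p q : ℕ} (V : Opens M) (e : Fin p ⊕ Fin q → A.Der V) : Prop where
  mem : ∀ k, e k ∈ A.derDeg V (frameParity k)
  basis : ∀ (W : Opens M) (hW : W ≤ V) (E : A.Der W),
    ∃! c : Fin p ⊕ Fin q → A.Sec W, E = ∑ k, c k • A.resDer hW (e k)

variable {A} in
/-- `g` is the supertrace of the endomorphism `T`: in every local homogeneous frame `e`, with
`T(e_k) = ∑_j c_k^j e_j`, the section `g` is `∑_k (-1)^{|e_k|} c_k^k`. As the coefficients stand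
on the left, this formula holds for `T` of either parity: writing `T(e_k) = ∑_j e_j b^j_k` with
`b^k_k = (-1)^{|e_k||T|} c_k^k`, it reads `∑_k (-1)^{|e_k|(1+|T|)} b^k_k`. -/
def IsSupertrace {U : Opens M} (T : A.DerOp U) (g : A.Sec U) : Prop :=
  ∀ (V : Opens M) (hV : V ≤ U) (p q : ℕ) (e : Fin p ⊕ Fin q → A.Der V)
    (c : Fin p ⊕ Fin q → Fin p ⊕ Fin q → A.Sec V),
    A.IsFrame V e → (∀ k, T V hV (e k) = ∑ j, c k j • e j) →
    A.res hV g = ∑ k, koszul (frameParity k) (frameParity k) • c k k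

open Classical in
variable {A} in
/-- The supertrace of an endomorphism; it has the junk value `0` if there is no unique section
that is the supertrace in every local homogeneous frame. -/
noncomputable def sTr {U : Opens M} (T : A.DerOp U) : A.Sec U :=
  if h : ∃! g : A.Sec U, IsSupertrace T g then h.choose else 0

/-- A graded linear connection: a left graded connection on the sheaf `Der A`. -/
structure LinearConnection where
  /-- `conn U D E` is the covariant derivative of `E` in the direction of `D`. -/
  conn : ∀ U : Opens M, A.Der U →ₗ[ℝ] A.Der U →ₗ[ℝ] A.Der U
  conn_res : ∀ (U V : Opens M) (h : V ≤ U) (D E : A.Der U),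
    A.resDer h (conn U D E) = conn V (A.resDer h D) (A.resDer h E)
  conn_mem : ∀ (U : Opens M) (i j : ZMod 2) (D E : A.Der U), D ∈ A.derDeg U i →
    E ∈ A.derDeg U j → conn U D E ∈ A.derDeg U (i + j)
  conn_smul_left : ∀ (U : Opens M) (f : A.Sec U) (D E : A.Der U),
    conn U (f • D) E = f • conn U D E
  leibniz : ∀ (U : Opens M) (i j : ZMod 2) (f : A.Sec U) (D E : A.Der U), f ∈ A.deg U j →
    D ∈ A.derDeg U i → conn U D (f • E) = A.act D f • E + koszul i j • (f • conn U D E)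

variable {A} in
/-- The operator `∇_D - ad_D` on `Der A` over `U`, for a graded vector field `D` over `U`. -/
def LinearConnection.subAd (C : A.LinearConnection) {U : Opens M} (D : A.Der U) : A.DerOp U :=
  fun V hV => C.conn V (A.resDer hV D) - A.ad (A.resDer hV D)

variable {A} in
/-- `div_∇(D) = sTr(∇_D - ad_D)`. -/
noncomputable def LinearConnection.div (C : A.LinearConnection) (U : Opens M) (D : A.Der U) :
    A.Sec U :=
  sTr (C.subAd D)

/-- Divergence operators: even morphisms of sheaves of vector spaces `δ : Der A → A` satisfying
`δ(f D) = f δ(D) + (-1)^{|f||D|} D(f)`. -/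
structure IsDivergenceOperator (δ : ∀ U : Opens M, A.Der U → A.Sec U) : Prop where
  add : ∀ (U : Opens M) (D E : A.Der U), δ U (D + E) = δ U D + δ U E
  real_smul : ∀ (U : Opens M) (r : ℝ) (D : A.Der U), δ U (r • D) = r • δ U D
  res : ∀ (U V : Opens M) (h : V ≤ U) (D : A.Der U), A.res h (δ U D) = δ V (A.resDer h D)
  mem : ∀ (U : Opens M) (i : ZMod 2) (D : A.Der U), D ∈ A.derDeg U i → δ U D ∈ A.deg U i
  smul : ∀ (U : Opens M) (i j : ZMod 2) (f : A.Sec U) (D : A.Der U), f ∈ A.deg U i →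
    D ∈ A.derDeg U j → δ U (f • D) = f * δ U D + koszul i j • A.act D f

/-- A splitting of `A` over `U`, i.e. an isomorphism of sheaves of superalgebras from
`C^∞_U ⊗ Λ(s_1, …, s_n)` to `A` restricted to `U`: it is given by an embedding of the sheaf of
smooth functions in the even part of `A` and by odd sections `s_1, …, s_n`, such that each section
`f` has a unique expansion `f = ∑_I f_I s_I` with smooth `f_I`, where `s_I = s_{i_1} ⋯ s_{i_k}` for
`I = {i_1 < ⋯ < i_k}`. -/
structure Splitting {m : ℕ} [ChartedSpace (EuclideanSpace ℝ (Fin m)) M] (n : ℕ)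
    (U : Opens M) where
  emb : ∀ V : Opens M, V ≤ U → (C^∞⟮𝓡 m, V; ℝ⟯ →ₐ[ℝ] A.Sec V)
  emb_res : ∀ (V W : Opens M) (hV : V ≤ U) (hW : W ≤ V) (f : C^∞⟮𝓡 m, V; ℝ⟯),
    A.res hW (emb V hV f) =
      emb W (hW.trans hV) (ContMDiffMap.restrictRingHom (𝓡 m) 𝓘(ℝ, ℝ) ℝ hW f)
  emb_mem : ∀ (V : Opens M) (hV : V ≤ U) (f : C^∞⟮𝓡 m, V; ℝ⟯), emb V hV f ∈ A.deg V 0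
  odd : Fin n → A.Sec U
  odd_mem : ∀ k, odd k ∈ A.deg U 1
  expansion : ∀ (V : Opens M) (hV : V ≤ U) (f : A.Sec V),
    ∃! c : Finset (Fin n) → C^∞⟮𝓡 m, V; ℝ⟯,
      f = ∑ I, emb V hV (c I) * (I.sort.map fun k => A.res hV (odd k)).prod

/-- `(M, A)` is a supermanifold of dimension `m|n` over the smooth `m`-manifold `M`: the sheaf `A`
is locally isomorphic, as a sheaf of superalgebras, to `C^∞_M ⊗ Λ(ℝ^n)`. -/
def IsSupermanifold (m n : ℕ) [ChartedSpace (EuclideanSpace ℝ (Fin m)) M]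
    [IsManifold (𝓡 m) ∞ M] : Prop :=
  ∀ x : M, ∃ U : Opens M, x ∈ U ∧ Nonempty (A.Splitting (m := m) n U)

end SuperalgebraSheaf

end Supergeometry

/-! ### Graded vector fields, the bracket, and the operator `∇_D - ad_D`. -/

namespace Supergeometry

namespace SuperalgebraSheaf

variable {M : Type u} [TopologicalSpace M] (A : SuperalgebraSheaf M)

/-! Both `∇_D` and `ad_D` obey a Leibniz rule with the same inhomogeneous term `D(f)E`. It cancels
in the difference, which is therefore `A`-linear up to the sign rule (`ad_smul`,
`isModuleEnd_subAd`). In a homogeneous frame such an operator is a matrix over `A`. A change of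
frame turns `c` into `P c Q` with signs, and the weights `(-1)^{|e_k|}` are exactly what makes the
trace of this product cyclic (`supertrace_conj`). So the local supertraces agree on overlaps and
glue to a section, unique because sections that agree locally are equal. For inhomogeneous `D` the
supertraces of the components are added.

The divergence rule comes from the one place where linearity in `D` fails: `∇` is `A`-linear in `D`,
whereas `[fD, E] = f[D, E] ∓ E(f)D`. Hence replacing `D` by `fD` adds to `f(∇_D - ad_D)` the
rank-one term `E ↦ ± E(f)D`. If `D = ∑ d_k e_k`, its supertrace is, up to sign, `∑ d_k e_k(f) =
D(f)`.

All this needs frames near every point, and that is where the local model is used. On a splitting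
over a chart domain, `∂/∂x_i` and `∂/∂s_j` are defined through the expansion `∑ f_I s_I`. They are
dual to the coordinates, hence independent. They generate because a homogeneous derivation killing
all coordinates is zero (`homDer_eq_zero`): on odd monomials by Leibniz, on smooth functions by
Hadamard's lemma, which makes every coefficient of `D(a)` vanish at an arbitrary point. -/

-- Zero is itself homogeneous, so the induction needs no separate zero case.
variable {A} in
theorem der_induction {U : Opens M} {p : A.Der U → Prop}
    (hom : ∀ i, ∀ D ∈ A.derDeg U i, p D) (add : ∀ D E, p D → p E → p (D + E)) (D : A.Der U) :
    p D := by
  obtain ⟨D, hD⟩ := D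
  exact Submodule.iSup_induction' (A.homDer U) (motive := fun D hD => p ⟨D, hD⟩)
    (fun i D hD => hom i _ hD) (hom 0 0 (zero_mem _)) (fun D E hD hE h h' => add _ _ h h') hD

variable {A} in
theorem derDeg_apply_mul {U : Opens M} {i j : ZMod 2} {D : A.Der U} (hD : D ∈ A.derDeg U i)
    {V : Opens M} (hV : V ≤ U) {f : A.Sec V} (hf : f ∈ A.deg V j) (g : A.Sec V) :
    D.1 V hV (f * g) = D.1 V hV f * g + koszul i j • (f * D.1 V hV g) :=
  hD.2.2 V hV j f g hf

variable {A} in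
theorem smul_mem_derDeg {U : Opens M} {i j : ZMod 2} {f : A.Sec U} (hf : f ∈ A.deg U i)
    {D : A.Der U} (hD : D ∈ A.derDeg U j) : f • D ∈ A.derDeg U (i + j) :=
  A.smul_mem_homDer hf hD

variable {A} in
theorem act_mem {U : Opens M} {i j : ZMod 2} {D : A.Der U} (hD : D ∈ A.derDeg U i)
    {f : A.Sec U} (hf : f ∈ A.deg U j) : A.act D f ∈ A.deg U (i + j) :=
  hD.2.1 U le_rfl j f hf

variable {A} in
theorem res_act {U V : Opens M} (h : V ≤ U) (D : A.Der U) (f : A.Sec U) :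
    A.res h (A.act D f) = A.act (A.resDer h D) (A.res h f) := by
  refine der_induction (p := fun D => A.res h (A.act D f) = A.act (A.resDer h D) (A.res h f))
    (fun i D hD => hD.1 U V le_rfl h f) (fun D E hD hE => ?_) D
  have h1 : A.act (D + E) f = A.act D f + A.act E f := rfl
  rw [h1, map_add, hD, hE, map_add]
  rfl

variable {A} in
theorem act_sum_smul {U : Opens M} {ι : Type*} [Fintype ι] (c : ι → A.Sec U) (e : ι → A.Der U)
    (f : A.Sec U) : A.act (∑ k, c k • e k) f = ∑ k, c k * A.act (e k) f := by
  have h : ∀ D : A.Der U, A.act D f =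
    (⟨⟨fun D : A.Der U => A.act D f, rfl⟩, fun _ _ => rfl⟩ : A.Der U →+ A.Sec U) D := fun _ => rfl
  rw [h, map_sum]
  refine Finset.sum_congr rfl fun k _ => ?_
  change A.res le_rfl (c k) * _ = _
  rw [res_self]
  rfl

theorem resDer_smul {U V : Opens M} (h : V ≤ U) (f : A.Sec U) (D : A.Der U) :
    A.resDer h (f • D) = A.res h f • A.resDer h D :=
  Subtype.ext <| LocalOp.ext fun W hW g => by
    change A.res (hW.trans h) f * _ = A.res hW (A.res h f) * _
    rw [res_res]
    rfl

theorem resDer_mem {U V : Opens M} (h : V ≤ U) {i : ZMod 2} {D : A.Der U}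
    (hD : D ∈ A.derDeg U i) : A.resDer h D ∈ A.derDeg V i :=
  A.resOp_mem_homDer h hD

theorem ad_mem {U : Opens M} {i j : ZMod 2} {D E : A.Der U} (hD : D ∈ A.derDeg U i)
    (hE : E ∈ A.derDeg U j) : A.ad D E ∈ A.derDeg U (i + j) :=
  A.opBracket_mem_homDer hD hE

theorem ad_add_left {U : Opens M} (D D' E : A.Der U) :
    A.ad (D + D') E = A.ad D E + A.ad D' E :=
  Subtype.ext (A.opBracket_add_left D.1 D'.1 E.1)

theorem ad_real_smul_left {U : Opens M} (r : ℝ) (D E : A.Der U) :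
    A.ad (r • D) E = r • A.ad D E := by
  refine Subtype.ext ?_
  change A.opBracket (r • D.1) E.1 = r • A.opBracket D.1 E.1
  simp only [opBracket, Finset.smul_sum]
  refine Finset.sum_congr rfl fun i _ => Finset.sum_congr rfl fun j _ =>
    LocalOp.ext fun V hV f => ?_
  simp only [map_smul, opMul, sub_apply, real_smul_apply, LinearMap.comp_apply, smul_sub]
  rw [smul_comm]

theorem ad_apply_of_mem {U : Opens M} {i j : ZMod 2} {D E : A.Der U} (hD : D ∈ A.derDeg U i)
    (hE : E ∈ A.derDeg U j) (V : Opens M) (hV : V ≤ U) (g : A.Sec V) :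
    (A.ad D E).1 V hV g = D.1 V hV (E.1 V hV g) - koszul i j • E.1 V hV (D.1 V hV g) := by
  have hD' : D.1 ∈ A.homDer U i := hD
  have hE' : E.1 ∈ A.homDer U j := hE
  change A.opBracket D.1 E.1 V hV g = _
  rw [A.opBracket_of_mem hD' hE', sub_apply]
  rfl

theorem resDer_ad {U V : Opens M} (h : V ≤ U) (D E : A.Der U) :
    A.resDer h (A.ad D E) = A.ad (A.resDer h D) (A.resDer h E) := by
  refine der_induction
    (p := fun D => A.resDer h (A.ad D E) = A.ad (A.resDer h D) (A.resDer h E))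
    (fun i D hD => ?_) (fun D D' hD hD' => ?_) D
  · refine der_induction
      (p := fun E => A.resDer h (A.ad D E) = A.ad (A.resDer h D) (A.resDer h E))
      (fun j E hE => ?_) (fun E E' hE hE' => ?_) E
    · refine Subtype.ext <| LocalOp.ext fun W hW g => ?_
      rw [A.ad_apply_of_mem (A.resDer_mem h hD) (A.resDer_mem h hE)]
      exact A.ad_apply_of_mem hD hE W (hW.trans h) g
    · rw [map_add, map_add, hE, hE', map_add, map_add]
  · rw [ad_add_left, map_add, hD, hD', map_add, ad_add_left]

/-- The inhomogeneous term is literally the one in the Leibniz rule of a connection; this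
coincidence makes `∇_D - ad_D` tensorial. -/
theorem ad_smul {U : Opens M} {i j : ZMod 2} {D : A.Der U} (hD : D ∈ A.derDeg U i)
    {f : A.Sec U} (hf : f ∈ A.deg U j) (E : A.Der U) :
    A.ad D (f • E) = A.act D f • E + koszul i j • (f • A.ad D E) := by
  refine der_induction
    (p := fun E => A.ad D (f • E) = A.act D f • E + koszul i j • (f • A.ad D E))
    (fun k E hE => ?_) (fun E E' hE hE' => ?_) E
  · refine Subtype.ext <| LocalOp.ext fun V hV g => ?_
    rw [A.ad_apply_of_mem hD (smul_mem_derDeg hf hE)]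
    change D.1 V hV (A.res hV f * E.1 V hV g) - koszul i (j + k) •
      (A.res hV f * E.1 V hV (D.1 V hV g)) = A.res hV (A.act D f) * E.1 V hV g +
      koszul i j • (A.res hV f * (A.ad D E).1 V hV g)
    rw [A.ad_apply_of_mem hD hE, derDeg_apply_mul hD hV (A.res_mem hV hf), res_act, koszul_add_right,
      mul_sub, smul_sub, mul_smul_comm, smul_smul, add_sub_assoc]
    rfl
  · rw [smul_add, map_add, hE, hE', map_add, smul_add, smul_add, smul_add]
    abel

/-- In `E ∘ (fD)` the Leibniz rule for `E` produces the extra term `E(f)D`, the source of `D(f)` in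
the divergence rule. The sign depends on the parity of `E`, so `E` has to be homogeneous. -/
theorem ad_smul_left {U : Opens M} {i j k : ZMod 2} {f : A.Sec U} (hf : f ∈ A.deg U i)
    {D : A.Der U} (hD : D ∈ A.derDeg U j) {E : A.Der U} (hE : E ∈ A.derDeg U k) :
    A.ad (f • D) E = f • A.ad D E - koszul (i + j) k • (A.act E f • D) := by
  refine Subtype.ext <| LocalOp.ext fun V hV g => ?_
  rw [A.ad_apply_of_mem (smul_mem_derDeg hf hD) hE]
  change A.res hV f * D.1 V hV (E.1 V hV g) - koszul (i + j) k •
      E.1 V hV (A.res hV f * D.1 V hV g) = (f • (A.ad D E).1 -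
      koszul (i + j) k • (A.act E f • D.1)) V hV g
  rw [sub_apply, smul_apply, real_smul_apply, smul_apply, A.ad_apply_of_mem hD hE,
    derDeg_apply_mul hE hV (A.res_mem hV hf), res_act, mul_sub, smul_add, smul_smul, mul_smul_comm,
    koszul_add_left, koszul_comm k i,
    show koszul i k * koszul j k * koszul i k = koszul i k * koszul i k * koszul j k by ring,
    koszul_mul_self, one_mul, sub_sub, add_comm (koszul j k • _)]
  rfl

variable {A} in
theorem LinearConnection.isModuleEnd_subAd (C : A.LinearConnection) {U : Opens M} {i : ZMod 2}
    {D : A.Der U} (hD : D ∈ A.derDeg U i) : IsModuleEnd i (C.subAd D) where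
  res V W hV hW E := by
    change A.resDer hW (C.conn V (A.resDer hV D) E - A.ad (A.resDer hV D) E) = _
    rw [map_sub, C.conn_res, resDer_ad]
    rfl
  mem V hV j E hE :=
    sub_mem (C.conn_mem V i j _ _ (A.resDer_mem hV hD) hE) (A.ad_mem (A.resDer_mem hV hD) hE)
  smul V hV j f E hf := by
    change C.conn V (A.resDer hV D) (f • E) - A.ad (A.resDer hV D) (f • E) =
      koszul i j • (f • (C.conn V (A.resDer hV D) E - A.ad (A.resDer hV D) E))
    rw [C.leibniz V i j f _ E hf (A.resDer_mem hV hD), A.ad_smul (A.resDer_mem hV hD) hf,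
      smul_sub, smul_sub]
    abel

variable {A} in
theorem LinearConnection.subAd_add (C : A.LinearConnection) {U : Opens M} (D D' : A.Der U)
    (V : Opens M) (hV : V ≤ U) (E : A.Der V) :
    C.subAd (D + D') V hV E = C.subAd D V hV E + C.subAd D' V hV E := by
  change C.conn V (A.resDer hV (D + D')) E - A.ad (A.resDer hV (D + D')) E =
    C.conn V (A.resDer hV D) E - A.ad (A.resDer hV D) E +
    (C.conn V (A.resDer hV D') E - A.ad (A.resDer hV D') E)
  rw [map_add, map_add, ad_add_left, LinearMap.add_apply]
  abel

variable {A} in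
theorem LinearConnection.subAd_real_smul (C : A.LinearConnection) {U : Opens M} (r : ℝ)
    (D : A.Der U) (V : Opens M) (hV : V ≤ U) (E : A.Der V) :
    C.subAd (r • D) V hV E = r • C.subAd D V hV E := by
  change C.conn V (A.resDer hV (r • D)) E - A.ad (A.resDer hV (r • D)) E =
    r • (C.conn V (A.resDer hV D) E - A.ad (A.resDer hV D) E)
  rw [map_smul, map_smul, ad_real_smul_left, LinearMap.smul_apply, smul_sub]

variable {A} in
theorem LinearConnection.subAd_smul (C : A.LinearConnection) {U : Opens M} {i j k : ZMod 2}
    {f : A.Sec U} (hf : f ∈ A.deg U i) {D : A.Der U} (hD : D ∈ A.derDeg U j)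
    (V : Opens M) (hV : V ≤ U) {E : A.Der V} (hE : E ∈ A.derDeg V k) :
    C.subAd (f • D) V hV E = A.res hV f • C.subAd D V hV E +
      koszul (i + j) k • (A.act E (A.res hV f) • A.resDer hV D) := by
  change C.conn V (A.resDer hV (f • D)) E - A.ad (A.resDer hV (f • D)) E =
    A.res hV f • (C.conn V (A.resDer hV D) E - A.ad (A.resDer hV D) E) + _
  rw [resDer_smul, C.conn_smul_left, A.ad_smul_left (A.res_mem hV hf) (A.resDer_mem hV hD) hE,
    smul_sub]
  abel

end SuperalgebraSheaf

/-! ### Sign identities. -/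

theorem koszul_zero_right (i : ZMod 2) : koszul i 0 = 1 := by simp [koszul]

/-- Turns identities between real signs into identities between integers, which `decide` can check
over all parities. -/
theorem koszul_eq_intCast (i j : ZMod 2) : koszul i j = ((-1 : ℤ) ^ (i.val * j.val) : ℤ) := by
  simp [koszul]

/-- The total sign in the trace of `P c Q` after `Q` is moved to the front: `x` is the parity of the
new frame member, `z` and `y` those of the old ones. The right side is free of `x`, so the sum over
the new frame can be carried out. -/
theorem koszul_conj (i x y z : ZMod 2) :
    koszul x x * koszul i (x + z) * koszul (x + z + (i + z + y)) (y + x) =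
      koszul y y * koszul i (y + z) := by
  simp only [koszul_eq_intCast, ← Int.cast_mul, Int.cast_inj]
  revert i x y z
  decide

/-- The sign of the rank-one trace, with `i = |f|`, `j = |D|`, `x = |e_k|`. On the left are the
supertrace weight and the bracket sign; on the right the sign of the divergence rule and that of
exchanging `d_k` with `e_k(f)`. -/
theorem koszul_self_mul_add (i j x : ZMod 2) :
    koszul x x * koszul (i + j) x = koszul i j * koszul (j + x) (x + i) := by
  simp only [koszul_eq_intCast, ← Int.cast_mul, Int.cast_inj]
  revert i j x
  decide

/-! ### Gluing of sections, homogeneous frames and the supertrace. -/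

namespace SuperalgebraSheaf

variable {M : Type u} [TopologicalSpace M] {A : SuperalgebraSheaf M}

/-- Two sections that agree locally are equal. -/
theorem section_ext {U : Opens M} {f g : A.Sec U}
    (h : ∀ x ∈ U, ∃ (V : Opens M) (hV : V ≤ U), x ∈ V ∧ A.res hV f = A.res hV g) : f = g := by
  choose V hV hx hfg using h
  refine A.toSheaf.eq_of_locally_eq' (fun x : U => V x.1 x.2) U (fun x => homOfLE (hV x.1 x.2))
    (fun x hxU => Opens.mem_iSup.2 ⟨⟨x, hxU⟩, hx x hxU⟩) f g fun x => hfg x.1 x.2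

/-- Compatible local sections glue. -/
theorem exists_glue {U : Opens M} {ι : Type*} (W : ι → Opens M) (hW : ∀ i, W i ≤ U)
    (hU : U ≤ iSup W) (s : ∀ i, A.Sec (W i))
    (hs : ∀ i j, A.res (V := W i ⊓ W j) inf_le_left (s i) =
      A.res (V := W i ⊓ W j) inf_le_right (s j)) :
    ∃ g : A.Sec U, ∀ i, A.res (hW i) g = s i :=
  (A.toSheaf.existsUnique_gluing' W U (fun i => homOfLE (hW i)) hU s hs).exists

theorem res_proj {U V : Opens M} (h : V ≤ U) (i : ZMod 2) (f : A.Sec U) :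
    A.res h (A.proj U i f) = A.proj V i (A.res h f) := by
  refine A.section_induction (p := fun f => A.res h (A.proj U i f) = A.proj V i (A.res h f))
    (by simp only [map_zero]) (fun j f hf => ?_) (fun f g hf hg => ?_) f
  · rw [A.proj_of_mem hf, A.proj_of_mem (A.res_mem h hf)]
    split_ifs
    · rfl
    · exact map_zero _
  · simp only [map_add, hf, hg]

/-- The parity `i - j` required of `f` is written `i + j`, which is the same modulo 2. -/
theorem opComp_smul {U : Opens M} (i : ZMod 2) {j : ZMod 2} (f : A.Sec U) {D : A.LocalOp U}
    (hD : D ∈ A.homDer U j) : A.opComp U i (f • D) = A.proj U (i + j) f • D := by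
  refine A.section_induction (p := fun f => A.opComp U i (f • D) = A.proj U (i + j) f • D)
    (by simp only [zero_smul, map_zero]) (fun k f hf => ?_) (fun f g hf hg => ?_) f
  · have h : i = k + j ↔ i + j = k := by
      clear hD hf
      revert i j k
      decide
    rw [A.opComp_of_mem (A.smul_mem_homDer hf hD), A.proj_of_mem hf]
    simp only [h]
    split_ifs
    · rfl
    · rw [zero_smul]
  · simp only [add_smul, map_add, hf, hg]

section Frames

variable {p q p' q' : ℕ} {V : Opens M} {e : Fin p ⊕ Fin q → A.Der V}
  {e' : Fin p' ⊕ Fin q' → A.Der V}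

theorem IsFrame.exists_coeff (he : A.IsFrame V e) (E : A.Der V) :
    ∃ c : Fin p ⊕ Fin q → A.Sec V, E = ∑ k, c k • e k :=
  (he.basis V le_rfl E).exists

theorem IsFrame.coeff_unique (he : A.IsFrame V e) {c c' : Fin p ⊕ Fin q → A.Sec V}
    (h : ∑ k, c k • e k = ∑ k, c' k • e k) : c = c' :=
  (he.basis V le_rfl _).unique rfl h

theorem IsFrame.restrict (he : A.IsFrame V e) {W : Opens M} (hW : W ≤ V) :
    A.IsFrame W fun k => A.resDer hW (e k) :=
  ⟨fun k => A.resDer_mem hW (he.mem k), fun W' hW' E => he.basis W' (hW'.trans hW) E⟩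

/-- Taking the component of parity `i` of the expansion replaces each coefficient by its projection.
Since `E` equals that component, uniqueness of coefficients shows that each one equals its
projection. -/
theorem IsFrame.coeff_mem (he : A.IsFrame V e) {i : ZMod 2} {E : A.Der V}
    (hE : E ∈ A.derDeg V i) {c : Fin p ⊕ Fin q → A.Sec V} (h : E = ∑ k, c k • e k)
    (k : Fin p ⊕ Fin q) : c k ∈ A.deg V (i + frameParity k) := by
  have hE' : E.1 ∈ A.homDer V i := hE
  have hsum : ∀ c : Fin p ⊕ Fin q → A.Sec V, (∑ k, c k • e k : A.Der V).1 =
      ∑ k, c k • (e k).1 := fun c => by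
    rw [AddSubmonoidClass.coe_finsetSum]
    rfl
  have h1 : E = ∑ k, A.proj V (i + frameParity k) (c k) • e k := by
    refine Subtype.ext ?_
    rw [hsum]
    have h2 := A.opComp_of_mem hE' i
    rw [if_pos rfl] at h2
    rw [← h2, h, hsum, map_sum]
    exact Finset.sum_congr rfl fun k _ => opComp_smul i (c k) (he.mem k)
  rw [congrFun (he.coeff_unique (h.symm.trans h1)) k]
  exact A.proj_mem _ _ _

/-- Invariance of the supertrace under an even change of basis, given by possibly rectangular
matrices. -/
theorem supertrace_conj {ι κ : Type*} [Fintype ι] [Fintype κ] [DecidableEq ι] (s : ι → ZMod 2)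
    (s' : κ → ZMod 2) (i : ZMod 2) {P : κ → ι → A.Sec V} {Q : ι → κ → A.Sec V}
    {c : ι → ι → A.Sec V} (hP : ∀ a k, P a k ∈ A.deg V (s' a + s k))
    (hQ : ∀ k a, Q k a ∈ A.deg V (s k + s' a)) (hc : ∀ k j, c k j ∈ A.deg V (i + s k + s j))
    (hQP : ∀ j k, ∑ a, Q j a * P a k = if j = k then 1 else 0) :
    ∑ a, koszul (s' a) (s' a) •
      ∑ k, ∑ j, koszul i (s' a + s k) • (P a k * c k j * Q j a) =
    ∑ k, koszul (s k) (s k) • c k k := by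
  -- Cyclicity: `Q` is commuted past `P c` so that `Q P` appears and can be summed over `a`.
  have h1 : ∀ a k j, koszul (s' a) (s' a) • koszul i (s' a + s k) • (P a k * c k j * Q j a) =
      (koszul (s j) (s j) * koszul i (s j + s k)) • (Q j a * P a k * c k j) := fun a k j => by
    rw [A.mul_comm V _ _ _ _ (SetLike.mul_mem_graded (hP a k) (hc k j)) (hQ j a), smul_smul,
      smul_smul, ← mul_assoc]
    rw [koszul_conj]
  have h2 : ∀ k, ∑ a, ∑ j,
      (koszul (s j) (s j) * koszul i (s j + s k)) • (Q j a * P a k * c k j) =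
      koszul (s k) (s k) • c k k := fun k => by
    rw [Finset.sum_comm, Finset.sum_eq_single k]
    · rw [← Finset.smul_sum, ← Finset.sum_mul, hQP, if_pos rfl, one_mul, CharTwo.add_self_eq_zero,
        koszul_zero_right, mul_one]
    · intro j _ hj
      rw [← Finset.smul_sum, ← Finset.sum_mul, hQP, if_neg hj, zero_mul, smul_zero]
    · intro h; exact absurd (Finset.mem_univ _) h
  simp only [Finset.smul_sum, h1]
  rw [Finset.sum_comm]
  exact Finset.sum_congr rfl fun k _ => h2 k

/-- The supertrace of an endomorphism does not depend on the frame. -/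
theorem IsModuleEnd.supertrace_eq {U : Opens M} {i : ZMod 2} {T : A.DerOp U}
    (hT : IsModuleEnd i T) (hV : V ≤ U) (he : A.IsFrame V e) (he' : A.IsFrame V e')
    {c : Fin p ⊕ Fin q → Fin p ⊕ Fin q → A.Sec V}
    {c' : Fin p' ⊕ Fin q' → Fin p' ⊕ Fin q' → A.Sec V}
    (hc : ∀ k, T V hV (e k) = ∑ j, c k j • e j)
    (hc' : ∀ k, T V hV (e' k) = ∑ j, c' k j • e' j) :
    ∑ k, koszul (frameParity k) (frameParity k) • c' k k =
      ∑ k, koszul (frameParity k) (frameParity k) • c k k := by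
  choose P hP using fun a => he.exists_coeff (e' a)
  choose Q hQ using fun k => he'.exists_coeff (e k)
  have hPm : ∀ a k, P a k ∈ A.deg V (frameParity a + frameParity k) := fun a k =>
    he.coeff_mem (he'.mem a) (hP a) k
  have hQm : ∀ k a, Q k a ∈ A.deg V (frameParity k + frameParity a) := fun k a =>
    he'.coeff_mem (he.mem k) (hQ k) a
  have hcm : ∀ k j, c k j ∈ A.deg V (i + frameParity k + frameParity j) := fun k j =>
    he.coeff_mem (hT.mem V hV _ _ (he.mem k)) (hc k) j
  -- Expand `e j` in `e'` and back, then compare coefficients in `e`. Only this one-sided inverse is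
  -- needed, so the ranks of the two frames need not be compared.
  have hQP : ∀ j k, ∑ a, Q j a * P a k = if j = k then 1 else 0 := fun j k => by
    refine congrFun (he.coeff_unique (c := fun k => ∑ a, Q j a * P a k)
      (c' := fun k => if j = k then 1 else 0) ?_) k
    simp only [ite_smul, one_smul, zero_smul, Finset.sum_ite_eq, Finset.mem_univ, if_true]
    conv_rhs => rw [hQ j]
    simp only [Finset.sum_smul]
    rw [Finset.sum_comm]
    refine Finset.sum_congr rfl fun a _ => ?_
    conv_rhs => rw [hP a]
    simp only [Finset.smul_sum, mul_smul]
  -- The matrix of `T` in the new frame is `P c Q`; the sign comes from pulling the coefficient `P a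
  -- k` out of `T`.
  have hc'' : ∀ a, c' a = fun b => ∑ k, ∑ j,
      koszul i (frameParity a + frameParity k) • (P a k * c k j * Q j b) := fun a => by
    refine he'.coeff_unique ?_
    rw [← hc' a]
    conv_lhs => rw [hP a]
    rw [map_sum]
    simp only [Finset.sum_smul]
    rw [Finset.sum_comm]
    refine Finset.sum_congr rfl fun k _ => ?_
    rw [Finset.sum_comm, hT.smul V hV _ _ _ (hPm a k), hc k, Finset.smul_sum, Finset.smul_sum]
    refine Finset.sum_congr rfl fun j _ => ?_
    conv_lhs => rw [hQ j]
    simp only [Finset.smul_sum, mul_smul, smul_assoc]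
  rw [← supertrace_conj (fun k => frameParity k) (fun k => frameParity k) i hPm hQm hcm hQP]
  simp only [hc'']

end Frames

theorem IsModuleEnd.res_coeff {U : Opens M} {i : ZMod 2} {T : A.DerOp U}
    (hT : IsModuleEnd i T) {V W : Opens M} (hV : V ≤ U) (hW : W ≤ V) {ι : Type*} [Fintype ι]
    {e : ι → A.Der V} {c : ι → ι → A.Sec V} (hc : ∀ k, T V hV (e k) = ∑ j, c k j • e j) (k : ι) :
    T W (hW.trans hV) (A.resDer hW (e k)) = ∑ j, A.res hW (c k j) • A.resDer hW (e j) := by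
  rw [← hT.res V W hV hW, hc, map_sum]
  simp only [resDer_smul]

variable (A) in
/-- `Der A` is locally free: it has a homogeneous frame near each point. -/
def HasLocalFrames (p q : ℕ) : Prop :=
  ∀ x : M, ∃ W : Opens M, x ∈ W ∧ ∃ e : Fin p ⊕ Fin q → A.Der W, A.IsFrame W e

theorem HasLocalFrames.exists_le {p q : ℕ} (hF : A.HasLocalFrames p q) {U : Opens M} {x : M}
    (hx : x ∈ U) : ∃ W ≤ U, x ∈ W ∧ ∃ e : Fin p ⊕ Fin q → A.Der W, A.IsFrame W e := by
  obtain ⟨W, hxW, e, he⟩ := hF x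
  exact ⟨U ⊓ W, inf_le_left, ⟨hx, hxW⟩, _, he.restrict inf_le_right⟩

theorem IsSupertrace.unique {p q : ℕ} (hF : A.HasLocalFrames p q) {U : Opens M} {T : A.DerOp U}
    {g g' : A.Sec U} (hg : IsSupertrace T g) (hg' : IsSupertrace T g') : g = g' := by
  refine section_ext fun x hx => ?_
  obtain ⟨W, hW, hxW, e, he⟩ := hF.exists_le hx
  choose c hc using fun k => he.exists_coeff (T W hW (e k))
  exact ⟨W, hW, hxW, (hg W hW p q e c he hc).trans (hg' W hW p q e c he hc).symm⟩

theorem IsModuleEnd.exists_isSupertrace {p q : ℕ} (hF : A.HasLocalFrames p q) {U : Opens M}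
    {i : ZMod 2} {T : A.DerOp U} (hT : IsModuleEnd i T) : ∃ g : A.Sec U, IsSupertrace T g := by
  choose W hW hxW e he using fun x : U => hF.exists_le x.2
  choose c hc using fun (x : U) k => (he x).exists_coeff (T (W x) (hW x) (e x k))
  have hres : ∀ (x : U) (V : Opens M) (hV : V ≤ W x), A.res hV
      (∑ k, koszul (frameParity k) (frameParity k) • c x k k) =
      ∑ k, koszul (frameParity k) (frameParity k) • A.res hV (c x k k) := fun x V hV => by
    rw [map_sum]
    simp only [map_smul]
  -- Over each `W x` take the supertrace in the chosen frame; frame independence on the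
  -- intersections is the gluing condition.
  obtain ⟨g, hg⟩ := exists_glue (A := A) W hW
    (fun x hx => Opens.mem_iSup.2 ⟨⟨x, hx⟩, hxW ⟨x, hx⟩⟩)
    (fun x => ∑ k, koszul (frameParity k) (frameParity k) • c x k k) fun x y => by
      rw [hres, hres]
      exact hT.supertrace_eq (inf_le_left.trans (hW x)) ((he y).restrict inf_le_right)
        ((he x).restrict inf_le_left) (hT.res_coeff (hW y) inf_le_right (hc y))
        (hT.res_coeff (hW x) inf_le_left (hc x))
  -- For an arbitrary frame over `V`, the formula is tested near each point, where it is compared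
  -- with the chosen frame.
  refine ⟨g, fun V hV p' q' e' c' he' hc' => section_ext fun x hx => ?_⟩
  refine ⟨V ⊓ W ⟨x, hV hx⟩, inf_le_left, ⟨hx, hxW _⟩, ?_⟩
  rw [res_res, ← A.res_res (hW ⟨x, hV hx⟩) inf_le_right, hg, hres, map_sum]
  simp only [map_smul]
  exact hT.supertrace_eq (inf_le_left.trans hV) (he'.restrict inf_le_left)
    ((he _).restrict inf_le_right) (hT.res_coeff hV inf_le_left hc')
    (hT.res_coeff (hW ⟨x, hV hx⟩) inf_le_right (hc _))

/-- Reduces each property of `div` to exhibiting a section that is a supertrace in every frame. -/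
theorem sTr_eq {p q : ℕ} (hF : A.HasLocalFrames p q) {U : Opens M} {T : A.DerOp U}
    {g : A.Sec U} (hg : IsSupertrace T g) : sTr T = g := by
  have h : ∃! g : A.Sec U, IsSupertrace T g := ⟨g, hg, fun g' hg' => hg'.unique hF hg⟩
  rw [sTr, dif_pos h]
  exact IsSupertrace.unique hF h.choose_spec.1 hg

/-! ### The divergence of a connection. -/

section Divergence

variable (C : A.LinearConnection) {U : Opens M}

theorem LinearConnection.isSupertrace_add {D D' : A.Der U} {g g' : A.Sec U}
    (hg : IsSupertrace (C.subAd D) g) (hg' : IsSupertrace (C.subAd D') g') :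
    IsSupertrace (C.subAd (D + D')) (g + g') := by
  intro V hV p q e c he hc
  choose a ha using fun k => he.exists_coeff (C.subAd D V hV (e k))
  choose b hb using fun k => he.exists_coeff (C.subAd D' V hV (e k))
  have h : ∀ k, c k = fun j => a k j + b k j := fun k => he.coeff_unique <| by
    rw [← hc, C.subAd_add, ha, hb, ← Finset.sum_add_distrib]
    simp only [add_smul]
  rw [map_add, hg V hV p q e a he ha, hg' V hV p q e b he hb, ← Finset.sum_add_distrib]
  simp only [h, smul_add]

/-- For inhomogeneous `D` frame independence is not directly available, but supertraces of the
homogeneous components add. -/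
theorem LinearConnection.exists_isSupertrace {p q : ℕ} (hF : A.HasLocalFrames p q)
    (D : A.Der U) : ∃ g : A.Sec U, IsSupertrace (C.subAd D) g :=
  der_induction (p := fun D => ∃ g : A.Sec U, IsSupertrace (C.subAd D) g)
    (fun _ _ hD => (C.isModuleEnd_subAd hD).exists_isSupertrace hF)
    (fun _ _ ⟨g, hg⟩ ⟨g', hg'⟩ => ⟨g + g', C.isSupertrace_add hg hg'⟩) D

theorem LinearConnection.isSupertrace_div {p q : ℕ} (hF : A.HasLocalFrames p q)
    (D : A.Der U) : IsSupertrace (C.subAd D) (C.div U D) := by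
  obtain ⟨g, hg⟩ := C.exists_isSupertrace hF D
  rw [LinearConnection.div, sTr_eq hF hg]
  exact hg

/-- Diagonal entries have parity `i + 2|e_k| = i`, so projection leaves every local trace unchanged.
Together with uniqueness this gives the evenness of `div`. -/
theorem IsModuleEnd.isSupertrace_proj {i : ZMod 2} {T : A.DerOp U} (hT : IsModuleEnd i T)
    {g : A.Sec U} (hg : IsSupertrace T g) : IsSupertrace T (A.proj U i g) := by
  intro V hV p q e c he hc
  have h : ∀ k, c k k ∈ A.deg V i := fun k => by
    have := he.coeff_mem (hT.mem V hV _ _ (he.mem k)) (hc k) k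
    rwa [add_assoc, CharTwo.add_self_eq_zero, add_zero] at this
  rw [res_proj, hg V hV p q e c he hc, map_sum]
  refine Finset.sum_congr rfl fun k _ => ?_
  rw [map_smul, A.proj_of_mem (h k), if_pos rfl]

theorem LinearConnection.isSupertrace_smul {i j : ZMod 2} {f : A.Sec U} (hf : f ∈ A.deg U i)
    {D : A.Der U} (hD : D ∈ A.derDeg U j) {g : A.Sec U} (hg : IsSupertrace (C.subAd D) g) :
    IsSupertrace (C.subAd (f • D)) (f * g + koszul i j • A.act D f) := by
  intro V hV p q e c he hc
  choose a ha using fun k => he.exists_coeff (C.subAd D V hV (e k))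
  obtain ⟨d, hd⟩ := he.exists_coeff (A.resDer hV D)
  have hdm := he.coeff_mem (A.resDer_mem hV hD) hd
  -- The second summand is the matrix of the rank-one term `E ↦ ± E(f)D`, with `D = ∑ d_l e_l`.
  have h : ∀ k, c k = fun l => A.res hV f * a k l +
      koszul (i + j) (frameParity k) • (A.act (e k) (A.res hV f) * d l) := fun k =>
    he.coeff_unique <| by
      rw [← hc, C.subAd_smul hf hD V hV (he.mem k), ha]
      conv_lhs => rw [hd]
      simp only [add_smul, Finset.sum_add_distrib, mul_smul, Finset.smul_sum, smul_assoc]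
  have hact : A.act (A.resDer hV D) (A.res hV f) = ∑ k, d k * A.act (e k) (A.res hV f) := by
    conv_lhs => rw [hd, act_sum_smul]
  rw [map_add, map_mul, map_smul, res_act, hact, hg V hV p q e a he ha, Finset.mul_sum,
    Finset.smul_sum, ← Finset.sum_add_distrib]
  refine Finset.sum_congr rfl fun k _ => ?_
  rw [h k, smul_add, mul_smul_comm, A.mul_comm V _ _ _ _ (hdm k)
    (act_mem (he.mem k) (A.res_mem hV hf)), smul_smul, smul_smul]
  rw [koszul_self_mul_add]

theorem LinearConnection.isDivergenceOperator_div {p q : ℕ} (hF : A.HasLocalFrames p q) :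
    A.IsDivergenceOperator C.div where
  add U D E := sTr_eq hF (C.isSupertrace_add (C.isSupertrace_div hF D) (C.isSupertrace_div hF E))
  real_smul U r D := by
    refine sTr_eq hF fun V hV p q e c he hc => ?_
    choose a ha using fun k => he.exists_coeff (C.subAd D V hV (e k))
    have h : ∀ k, c k = fun l => r • a k l := fun k => he.coeff_unique <| by
      rw [← hc, C.subAd_real_smul, ha, Finset.smul_sum]
      simp only [smul_assoc]
    rw [map_smul, C.isSupertrace_div hF D V hV p q e a he ha, Finset.smul_sum]
    refine Finset.sum_congr rfl fun k _ => ?_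
    rw [h k, smul_comm]
  res U V hV D := (sTr_eq hF fun W hW p q e c he hc => by
    rw [res_res]
    exact C.isSupertrace_div hF D W (hW.trans hV) p q e c he hc).symm
  mem U i D hD := by
    have h := C.isSupertrace_div hF D
    rw [h.unique hF ((C.isModuleEnd_subAd hD).isSupertrace_proj h)]
    exact A.proj_mem _ _ _
  smul U i j f D hf hD := sTr_eq hF (C.isSupertrace_smul hf hD (C.isSupertrace_div hF D))

end Divergence

end SuperalgebraSheaf

/-! ### Hadamard's lemma on Euclidean space. -/

open MeasureTheory in
theorem hasFDerivAt_integral_of_contDiff {E F : Type*} [NormedAddCommGroup E] [NormedSpace ℝ E]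
    [FiniteDimensional ℝ E] [NormedAddCommGroup F] [NormedSpace ℝ F] [CompleteSpace F]
    {H : E × ℝ → F} (hH : ContDiff ℝ 1 H) (x₀ : E) :
    HasFDerivAt (fun x => ∫ t in (0 : ℝ)..1, H (x, t))
      (∫ t in (0 : ℝ)..1, (fderiv ℝ H (x₀, t)).comp (ContinuousLinearMap.inl ℝ E ℝ)) x₀ := by
  have hH' : Continuous fun q : E × ℝ =>
      (fderiv ℝ H q).comp (ContinuousLinearMap.inl ℝ E ℝ) :=
    (hH.continuous_fderiv one_ne_zero).clm_comp continuous_const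
  -- Compactness gives a constant dominating the derivative of the integrand near `x₀`.
  obtain ⟨B, hB⟩ := ((isCompact_closedBall x₀ 1).prod (isCompact_Icc (a := (0 : ℝ)) (b := 1))).exists_bound_of_continuousOn hH'.continuousOn
  refine intervalIntegral.hasFDerivAt_integral_of_dominated_of_fderiv_le (bound := fun _ => B)
    (F' := fun x t => (fderiv ℝ H (x, t)).comp (ContinuousLinearMap.inl ℝ E ℝ))
    (Metric.closedBall_mem_nhds x₀ one_pos) (Filter.Eventually.of_forall fun x => ?_) ?_ ?_ ?_ ?_ ?_
  · exact (hH.continuous.comp (Continuous.prodMk_right x)).aestronglyMeasurable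
  · exact (hH.continuous.comp (Continuous.prodMk_right x₀)).intervalIntegrable _ _
  · exact (hH'.comp (Continuous.prodMk_right x₀)).aestronglyMeasurable
  · refine Filter.Eventually.of_forall fun t ht x hx => hB (x, t) ⟨hx, ?_⟩
    rw [Set.uIoc_of_le zero_le_one] at ht
    exact ⟨ht.1.le, ht.2⟩
  · exact intervalIntegrable_const
  · refine Filter.Eventually.of_forall fun t _ x _ => ?_
    exact ((hH.differentiable one_ne_zero (x, t)).hasFDerivAt).comp x (hasFDerivAt_prodMk_left x t)

/-- The derivative of the integral is the integral of the partial derivative, which takes values in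
`E →L[ℝ] F`; hence the induction on `n` runs over all `F` at once. -/
theorem contDiff_integral_nat {E : Type u} [NormedAddCommGroup E] [NormedSpace ℝ E]
    [FiniteDimensional ℝ E] (n : ℕ) : ∀ {F : Type u} [NormedAddCommGroup F] [NormedSpace ℝ F]
    [CompleteSpace F] {H : E × ℝ → F}, ContDiff ℝ n H →
    ContDiff ℝ n fun x => ∫ t in (0 : ℝ)..1, H (x, t) := by
  induction n with
  | zero =>
    intro F _ _ _ H hH
    rw [Nat.cast_zero, contDiff_zero] at hH ⊢
    exact intervalIntegral.continuous_parametric_intervalIntegral_of_continuous'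
      (f := fun x t => H (x, t)) hH 0 1
  | succ n ih =>
    intro F _ _ _ H hH
    have h1 : ContDiff ℝ 1 H := hH.of_le (by exact_mod_cast Nat.succ_le_succ n.zero_le)
    rw [Nat.cast_succ, contDiff_succ_iff_hasFDerivAt]
    refine ⟨_, ih (H := fun q => (fderiv ℝ H q).comp (ContinuousLinearMap.inl ℝ E ℝ)) ?_,
      hasFDerivAt_integral_of_contDiff h1⟩
    rw [Nat.cast_succ] at hH
    exact (hH.fderiv_right (m := n) le_rfl).clm_comp contDiff_const

/-- Hadamard's lemma for functions on the whole space. -/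
theorem exists_hadamard {m : ℕ} {f : EuclideanSpace ℝ (Fin m) → ℝ} (hf : ContDiff ℝ ∞ f)
    (p : EuclideanSpace ℝ (Fin m)) :
    ∃ g : Fin m → EuclideanSpace ℝ (Fin m) → ℝ, (∀ i, ContDiff ℝ ∞ (g i)) ∧
      ∀ x, f x = f p + ∑ i, (x i - p i) * g i x := by
  have hf' : ContDiff ℝ ∞ (fderiv ℝ f) := hf.fderiv_right (by simp)
  have key : ∀ i, ContDiff ℝ ∞ fun q : EuclideanSpace ℝ (Fin m) × ℝ =>
      fderiv ℝ f (p + q.2 • (q.1 - p)) (EuclideanSpace.single i 1) := fun i =>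
    (hf'.comp (by fun_prop)).clm_apply contDiff_const
  -- Integrate the derivative of `f` along the segment from `p` to `x`.
  refine ⟨fun i x => ∫ t in (0 : ℝ)..1, fderiv ℝ f (p + t • (x - p)) (EuclideanSpace.single i 1),
    fun i => contDiff_infty.2 fun n => contDiff_integral_nat n (contDiff_infty.1 (key i) n),
    fun x => ?_⟩
  have hc : ∀ v, Continuous fun t : ℝ => fderiv ℝ f (p + t • (x - p)) v := fun v =>
    (hf'.continuous.comp (by fun_prop)).clm_apply continuous_const
  have h1 : ∫ t in (0 : ℝ)..1, fderiv ℝ f (p + t • (x - p)) (x - p) = f x - f p := by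
    have := intervalIntegral.integral_eq_sub_of_hasDerivAt (a := 0) (b := 1)
      (f := fun t : ℝ => f (p + t • (x - p)))
      (f' := fun t : ℝ => fderiv ℝ f (p + t • (x - p)) (x - p)) (fun t _ => ?_)
      ((hc _).intervalIntegrable _ _)
    · simpa using this
    · have h2 : HasDerivAt (fun t : ℝ => p + t • (x - p)) (x - p) t := by
        simpa using ((hasDerivAt_id t).smul_const (x - p)).const_add p
      exact ((hf.differentiable (by simp)) _).hasFDerivAt.comp_hasDerivAt t h2
  have h3 : x - p = ∑ i, (x i - p i) • EuclideanSpace.single i (1 : ℝ) := by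
    ext j
    simp [Pi.single_apply]
  have h4 : ∀ t : ℝ, fderiv ℝ f (p + t • (x - p)) (x - p) =
      ∑ i, (x i - p i) * fderiv ℝ f (p + t • (x - p)) (EuclideanSpace.single i 1) := fun t => by
    -- This also rewrites `x - p` inside the base point; `← h3` below folds it back.
    conv_lhs => rw [h3]
    rw [map_sum]
    simp only [map_smul, smul_eq_mul, ← h3]
  simp only [h4] at h1
  have hint : ∀ i ∈ Finset.univ, IntervalIntegrable (fun t : ℝ => (x i - p i) *
      fderiv ℝ f (p + t • (x - p)) (EuclideanSpace.single i 1)) MeasureTheory.volume 0 1 :=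
    fun i _ => (continuous_const.mul (hc _)).intervalIntegrable _ _
  rw [intervalIntegral.integral_finsetSum hint] at h1
  simp only [intervalIntegral.integral_const_mul] at h1
  rw [h1]
  ring

/-- Hadamard's lemma, local version. -/
theorem exists_local_hadamard {m : ℕ} {f : EuclideanSpace ℝ (Fin m) → ℝ}
    {s : Set (EuclideanSpace ℝ (Fin m))} (hs : IsOpen s) (hf : ContDiffOn ℝ ∞ f s)
    {p : EuclideanSpace ℝ (Fin m)} (hp : p ∈ s) :
    ∃ g : Fin m → EuclideanSpace ℝ (Fin m) → ℝ, (∀ i, ContDiff ℝ ∞ (g i)) ∧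
      ∀ᶠ x in nhds p, f x = f p + ∑ i, (x i - p i) * g i x := by
  obtain ⟨r, hr, hrs⟩ := Metric.nhds_basis_closedBall.mem_iff.1 (hs.mem_nhds hp)
  -- The support of `χ` lies in a closed ball inside `s`, so `χ f` is smooth everywhere; it equals
  -- `f` near `p`.
  let χ : ContDiffBump p := ⟨r / 2, r, half_pos hr, half_lt_self hr⟩
  have hχf : ContDiff ℝ ∞ fun x => χ x * f x := by
    refine contDiff_iff_contDiffAt.2 fun x => ?_
    by_cases hx : x ∈ s
    · exact χ.contDiff.contDiffAt.mul (hf.contDiffAt (hs.mem_nhds hx))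
    · have : x ∉ tsupport χ := fun h => hx (hrs (by rwa [χ.tsupport_eq] at h))
      refine contDiffAt_const (c := (0 : ℝ)) |>.congr_of_eventuallyEq ?_
      filter_upwards [(notMem_tsupport_iff_eventuallyEq).1 this] with y hy
      simp [hy]
  obtain ⟨g, hg, h⟩ := exists_hadamard hχf p
  refine ⟨g, hg, ?_⟩
  filter_upwards [χ.eventuallyEq_one] with x hx
  have := h x
  rwa [hx, χ.eventuallyEq_one.self_of_nhds, Pi.one_apply, one_mul, Pi.one_apply, one_mul] at this

/-! ### Smooth functions and partial derivatives in a chart. -/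

section SmoothFunctions

variable {m : ℕ} {M : Type u} [TopologicalSpace M] [ChartedSpace (EuclideanSpace ℝ (Fin m)) M]

/-- Restriction of smooth functions. -/
noncomputable abbrev resSmooth {V W : Opens M} (hW : W ≤ V) :
    C^∞⟮𝓡 m, V; ℝ⟯ →+* C^∞⟮𝓡 m, W; ℝ⟯ :=
  ContMDiffMap.restrictRingHom (𝓡 m) 𝓘(ℝ, ℝ) ℝ hW

theorem resSmooth_apply {V W : Opens M} (hW : W ≤ V) (f : C^∞⟮𝓡 m, V; ℝ⟯) (x : W) :
    resSmooth hW f x = f ⟨x.1, hW x.2⟩ := rfl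

open Classical in
/-- A function on an open set in the chart at `x₀`, extended by zero. -/
noncomputable def chartRep (x₀ : M) {V : Opens M} (f : V → ℝ) (y : EuclideanSpace ℝ (Fin m)) : ℝ :=
  if h : (chartAt (EuclideanSpace ℝ (Fin m)) x₀).symm y ∈ V then f ⟨_, h⟩ else 0

/-- The image of `V` in the chart at `x₀`. -/
def chartSet (m : ℕ) [ChartedSpace (EuclideanSpace ℝ (Fin m)) M] (x₀ : M) (V : Opens M) :
    Set (EuclideanSpace ℝ (Fin m)) :=
  (chartAt (EuclideanSpace ℝ (Fin m)) x₀).target ∩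
    (chartAt (EuclideanSpace ℝ (Fin m)) x₀).symm ⁻¹' V

theorem isOpen_chartSet (x₀ : M) (V : Opens M) : IsOpen (chartSet m x₀ V) :=
  (chartAt (EuclideanSpace ℝ (Fin m)) x₀).symm.isOpen_inter_preimage V.2

variable (m) in
/-- The domain of the chart at `x₀`. -/
def chartDomain (x₀ : M) : Opens M :=
  ⟨(chartAt (EuclideanSpace ℝ (Fin m)) x₀).source,
    (chartAt (EuclideanSpace ℝ (Fin m)) x₀).open_source⟩

theorem chart_mem_chartSet {x₀ : M} {V : Opens M} {x : M} (hx : x ∈ V)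
    (hx' : x ∈ chartDomain m x₀) :
    chartAt (EuclideanSpace ℝ (Fin m)) x₀ x ∈ chartSet m x₀ V := by
  refine ⟨(chartAt _ x₀).map_source hx', ?_⟩
  rw [Set.mem_preimage, (chartAt (EuclideanSpace ℝ (Fin m)) x₀).left_inv hx']
  exact hx

theorem chartRep_chart {x₀ : M} {V : Opens M} (f : V → ℝ) (x : V)
    (hx' : x.1 ∈ chartDomain m x₀) :
    chartRep x₀ f (chartAt (EuclideanSpace ℝ (Fin m)) x₀ x.1) = f x := by
  have h := (chartAt (EuclideanSpace ℝ (Fin m)) x₀).left_inv hx'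
  have h1 : (chartAt (EuclideanSpace ℝ (Fin m)) x₀).symm
      (chartAt (EuclideanSpace ℝ (Fin m)) x₀ x.1) ∈ V := by rw [h]; exact x.2
  rw [chartRep, dif_pos h1]
  congr 1
  exact Subtype.ext h

theorem chartRep_add (x₀ : M) {V : Opens M} (f g : V → ℝ) :
    (chartRep x₀ (f + g) : EuclideanSpace ℝ (Fin m) → ℝ) = chartRep x₀ f + chartRep x₀ g := by
  funext y
  simp only [chartRep, Pi.add_apply]
  split_ifs <;> simp

theorem chartRep_smul (x₀ : M) {V : Opens M} (r : ℝ) (f : V → ℝ) :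
    (chartRep x₀ (r • f) : EuclideanSpace ℝ (Fin m) → ℝ) = r • chartRep x₀ f := by
  funext y
  simp only [chartRep, Pi.smul_apply]
  split_ifs <;> simp

theorem chartRep_mul (x₀ : M) {V : Opens M} (f g : V → ℝ) :
    (chartRep x₀ (f * g) : EuclideanSpace ℝ (Fin m) → ℝ) = chartRep x₀ f * chartRep x₀ g := by
  funext y
  simp only [chartRep, Pi.mul_apply]
  split_ifs <;> simp

variable [IsManifold (𝓡 m) ∞ M]

theorem contDiffOn_chartRep (x₀ : M) {V : Opens M} (f : C^∞⟮𝓡 m, V; ℝ⟯) :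
    ContDiffOn ℝ ∞ (chartRep x₀ f : EuclideanSpace ℝ (Fin m) → ℝ) (chartSet m x₀ V) := by
  classical
  let F : M → ℝ := fun x => if h : x ∈ V then f ⟨x, h⟩ else 0
  have hF : ContMDiffOn (𝓡 m) 𝓘(ℝ, ℝ) ∞ F V := fun x hx => by
    refine (contMDiffAt_subtype_iff (U := V) (x := ⟨x, hx⟩).1 ?_).contMDiffWithinAt
    convert! f.contMDiff ⟨x, hx⟩ using 1
    funext y
    exact dif_pos y.2
  rw [← contMDiffOn_iff_contDiffOn]
  exact hF.comp ((contMDiffOn_chart_symm (I := 𝓡 m) (x := x₀)).mono Set.inter_subset_left)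
    fun y hy => hy.2

theorem contMDiff_comp_chart {x₀ : M} {V : Opens M} (hV : V ≤ chartDomain m x₀)
    {g : EuclideanSpace ℝ (Fin m) → ℝ} (hg : ContDiffOn ℝ ∞ g (chartSet m x₀ V)) :
    ContMDiff (𝓡 m) 𝓘(ℝ, ℝ) ∞
      fun x : V => g (chartAt (EuclideanSpace ℝ (Fin m)) x₀ x.1) := fun x => by
  refine contMDiffAt_subtype_iff (f := fun x => g (chartAt (EuclideanSpace ℝ (Fin m)) x₀ x)) |>.2 ?_
  have h1 : ContMDiffOn (𝓡 m) 𝓘(ℝ, ℝ) ∞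
      (fun x => g (chartAt (EuclideanSpace ℝ (Fin m)) x₀ x)) V :=
    (contMDiffOn_iff_contDiffOn.2 hg).comp ((contMDiffOn_chart (I := 𝓡 m) (x := x₀)).mono hV)
      fun y hy => chart_mem_chartSet hy (hV hy)
  exact h1.contMDiffAt (V.2.mem_nhds x.2)

/-- The smooth function on `V` given by a smooth function in the chart. -/
def compChart {x₀ : M} {V : Opens M} (hV : V ≤ chartDomain m x₀)
    (g : EuclideanSpace ℝ (Fin m) → ℝ) (hg : ContDiffOn ℝ ∞ g (chartSet m x₀ V)) :
    C^∞⟮𝓡 m, V; ℝ⟯ :=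
  ⟨_, contMDiff_comp_chart hV hg⟩

theorem compChart_apply {x₀ : M} {V : Opens M} (hV : V ≤ chartDomain m x₀)
    (g : EuclideanSpace ℝ (Fin m) → ℝ) (hg : ContDiffOn ℝ ∞ g (chartSet m x₀ V)) (x : V) :
    compChart hV g hg x = g (chartAt (EuclideanSpace ℝ (Fin m)) x₀ x.1) := rfl

theorem differentiableAt_chartRep {x₀ : M} {V : Opens M} (f : C^∞⟮𝓡 m, V; ℝ⟯) {x : V}
    (hx : x.1 ∈ chartDomain m x₀) :
    DifferentiableAt ℝ (chartRep x₀ f) (chartAt (EuclideanSpace ℝ (Fin m)) x₀ x.1) :=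
  ((contDiffOn_chartRep x₀ f).contDiffAt
    ((isOpen_chartSet x₀ V).mem_nhds (chart_mem_chartSet x.2 hx))).differentiableAt (by simp)

/-- The partial derivative `∂/∂x_i` in the chart at `x₀`. -/
noncomputable def pderiv {x₀ : M} {V : Opens M} (hV : V ≤ chartDomain m x₀) (i : Fin m) :
    C^∞⟮𝓡 m, V; ℝ⟯ →ₗ[ℝ] C^∞⟮𝓡 m, V; ℝ⟯ where
  toFun f := compChart hV
    (fun y => fderiv ℝ (chartRep x₀ f) y (EuclideanSpace.single i 1))
    (((contDiffOn_chartRep x₀ f).fderiv_of_isOpen (isOpen_chartSet x₀ V) (by simp)).clm_apply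
      contDiffOn_const)
  map_add' f g := by
    ext x
    change fderiv ℝ (chartRep x₀ (⇑f + ⇑g)) _ _ = fderiv ℝ (chartRep x₀ f) _ _ +
      fderiv ℝ (chartRep x₀ g) _ _
    rw [chartRep_add, fderiv_add (differentiableAt_chartRep f (hV x.2))
      (differentiableAt_chartRep g (hV x.2))]
    rfl
  map_smul' r f := by
    ext x
    change fderiv ℝ (chartRep x₀ (r • ⇑f)) _ _ = r • fderiv ℝ (chartRep x₀ f) _ _
    rw [chartRep_smul, fderiv_const_smul (differentiableAt_chartRep f (hV x.2))]
    rfl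

theorem pderiv_apply {x₀ : M} {V : Opens M} (hV : V ≤ chartDomain m x₀) (i : Fin m)
    (f : C^∞⟮𝓡 m, V; ℝ⟯) (x : V) : pderiv hV i f x = fderiv ℝ (chartRep x₀ f)
      (chartAt (EuclideanSpace ℝ (Fin m)) x₀ x.1) (EuclideanSpace.single i 1) := rfl

theorem pderiv_mul {x₀ : M} {V : Opens M} (hV : V ≤ chartDomain m x₀) (i : Fin m)
    (f g : C^∞⟮𝓡 m, V; ℝ⟯) : pderiv hV i (f * g) = pderiv hV i f * g + f * pderiv hV i g := by
  ext x
  change fderiv ℝ (chartRep x₀ (⇑f * ⇑g)) _ _ = pderiv hV i f x * g x + f x * pderiv hV i g x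
  rw [chartRep_mul, fderiv_mul (differentiableAt_chartRep f (hV x.2))
    (differentiableAt_chartRep g (hV x.2)), chartRep_chart _ x (hV x.2),
    chartRep_chart _ x (hV x.2), pderiv_apply, pderiv_apply]
  simp only [add_apply, smul_apply, smul_eq_mul]
  ring

theorem resSmooth_pderiv {x₀ : M} {V W : Opens M} (hV : V ≤ chartDomain m x₀) (hW : W ≤ V)
    (i : Fin m) (f : C^∞⟮𝓡 m, V; ℝ⟯) :
    resSmooth hW (pderiv hV i f) = pderiv (hW.trans hV) i (resSmooth hW f) := by
  ext x
  rw [resSmooth_apply, pderiv_apply, pderiv_apply]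
  congr 1
  -- The derivative depends only on the germ, and on the chart image of `W` neither representative
  -- takes its default value.
  refine Filter.EventuallyEq.fderiv_eq ?_
  filter_upwards [(isOpen_chartSet x₀ W).mem_nhds
    (chart_mem_chartSet (m := m) x.2 (hV (hW x.2)))] with y hy
  rw [chartRep, chartRep, dif_pos (hW hy.2), dif_pos (show _ ∈ W from hy.2)]
  rfl

/-- The coordinate function `x_k` of the chart at `x₀`. -/
def coord {x₀ : M} {V : Opens M} (hV : V ≤ chartDomain m x₀) (k : Fin m) : C^∞⟮𝓡 m, V; ℝ⟯ :=
  compChart hV (fun y => y k) (by fun_prop)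

theorem pderiv_coord {x₀ : M} {V : Opens M} (hV : V ≤ chartDomain m x₀) (i k : Fin m) :
    pderiv hV i (coord hV k) = if i = k then 1 else 0 := by
  ext x
  rw [pderiv_apply]
  have h : chartRep x₀ (coord hV k) =ᶠ[nhds (chartAt (EuclideanSpace ℝ (Fin m)) x₀ x.1)]
      (EuclideanSpace.proj k : EuclideanSpace ℝ (Fin m) →L[ℝ] ℝ) := by
    filter_upwards [(isOpen_chartSet x₀ V).mem_nhds
      (chart_mem_chartSet (m := m) x.2 (hV x.2))] with y hy
    rw [chartRep, dif_pos (show _ ∈ V from hy.2), coord, compChart_apply]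
    rw [(chartAt (EuclideanSpace ℝ (Fin m)) x₀).right_inv hy.1]
    rfl
  rw [h.fderiv_eq, ContinuousLinearMap.fderiv]
  by_cases hik : i = k
  · subst hik
    simp
  · rw [if_neg hik]
    simp [Ne.symm hik]

/-- Hadamard's lemma in a chart. -/
theorem exists_hadamard_chart {x₀ : M} {V : Opens M} (hV : V ≤ chartDomain m x₀)
    (f : C^∞⟮𝓡 m, V; ℝ⟯) (x : V) :
    ∃ (W : Opens M) (hW : W ≤ V) (hx : x.1 ∈ W) (r : Fin m → ℝ) (g : Fin m → C^∞⟮𝓡 m, W; ℝ⟯),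
      (∀ i, coord (hW.trans hV) i ⟨x.1, hx⟩ = r i) ∧
      resSmooth hW f = algebraMap ℝ _ (f x) +
        ∑ i, (coord (hW.trans hV) i - algebraMap ℝ _ (r i)) * g i := by
  obtain ⟨g, hg, h⟩ := exists_local_hadamard (isOpen_chartSet x₀ V) (contDiffOn_chartRep x₀ f)
    (chart_mem_chartSet x.2 (hV x.2))
  obtain ⟨s, hs, hso, hxs⟩ := eventually_nhds_iff.1 h
  let φ := chartAt (EuclideanSpace ℝ (Fin m)) x₀
  -- The points of `V` whose chart image lies where the Euclidean identity holds.
  let W : Opens M := ⟨V ∩ (φ.source ∩ φ ⁻¹' s), V.2.inter (φ.isOpen_inter_preimage hso)⟩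
  have hW : W ≤ V := Set.inter_subset_left
  refine ⟨W, hW, ⟨x.2, hV x.2, hxs⟩, fun i => φ x.1 i,
    fun i => compChart (hW.trans hV) (g i) (hg i).contDiffOn, fun i => rfl, ?_⟩
  ext y
  have h1 := hs (φ y.1) y.2.2.2
  rw [chartRep_chart f x (hV x.2)] at h1
  have h2 := chartRep_chart f ⟨y.1, hW y.2⟩ (hV (hW y.2))
  rw [resSmooth_apply, ← h2, h1, ContMDiffMap.coe_add, Pi.add_apply]
  congr 1
  have h3 : ∀ F : Fin m → C^∞⟮𝓡 m, W; ℝ⟯, (∑ i, F i) y = ∑ i, F i y := fun F =>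
    map_sum ((Pi.evalRingHom (fun _ : W => ℝ) y).comp ContMDiffMap.coeFnRingHom) F _
  rw [h3]
  rfl

end SmoothFunctions

/-! ### Monomials in anticommuting elements. -/

section Grassmann

variable {n : ℕ}

/-- The sign `(-1)^k` where `k` is the number of elements of `I` below `j`. -/
def belowSign (j : Fin n) (I : Finset (Fin n)) : ℝ := (-1) ^ (I.filter (· < j)).card

theorem belowSign_insert {j a : Fin n} {I : Finset (Fin n)} (ha : a ∉ I) :
    belowSign j (insert a I) = (if a < j then -1 else 1) * belowSign j I := by
  unfold belowSign
  rw [Finset.filter_insert]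
  split_ifs with h
  · rw [Finset.card_insert_of_notMem (fun h' => ha (Finset.mem_filter.1 h').1), pow_succ']
  · rw [one_mul]

theorem belowSign_mul_self (j : Fin n) (I : Finset (Fin n)) :
    belowSign j I * belowSign j I = 1 := by
  unfold belowSign
  rw [← mul_pow]
  norm_num

theorem belowSign_eq_one {j : Fin n} {I : Finset (Fin n)} (h : ∀ x ∈ I, j < x) :
    belowSign j I = 1 := by
  rw [belowSign, Finset.filter_false_of_mem fun x hx => (h x hx).asymm, Finset.card_empty,
    pow_zero]

theorem belowSign_erase (j : Fin n) (I : Finset (Fin n)) :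
    belowSign j (I.erase j) = belowSign j I := by
  unfold belowSign
  congr 2
  ext x
  simp only [Finset.mem_filter, Finset.mem_erase]
  exact ⟨fun h => ⟨h.1.2, h.2⟩, fun h => ⟨⟨h.2.ne, h.1⟩, h.2⟩⟩

variable {R : Type*} [Ring R]

/-- The product of the `s_i`, `i ∈ I`, in increasing order. -/
def mono (s : Fin n → R) (I : Finset (Fin n)) : R := (I.sort.map s).prod

theorem mono_empty (s : Fin n → R) : mono s ∅ = 1 := by
  rw [mono, Finset.sort_empty]
  rfl

theorem mono_insert {s : Fin n → R} {a : Fin n} {I : Finset (Fin n)} (h : ∀ x ∈ I, a < x) :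
    mono s (insert a I) = s a * mono s I := by
  rw [mono, Finset.sort_insert _ (fun b hb => (h b hb).le) fun ha => (h a ha).false,
    List.map_cons, List.prod_cons]
  rfl

theorem mono_singleton (s : Fin n → R) (a : Fin n) : mono s {a} = s a := by
  have := mono_insert (s := s) (a := a) (I := ∅) (by simp)
  rwa [mono_empty, mul_one] at this

variable [Algebra ℝ R]

/-- The derivative of `s_I` with respect to `s_j`. -/
def monoDeriv (s : Fin n → R) (j : Fin n) (I : Finset (Fin n)) : R :=
  if j ∈ I then belowSign j I • mono s (I.erase j) else 0

/-- Moving `s j` to its sorted place passes the smaller indices, one sign each; a repeated factor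
gives zero since squares vanish. -/
theorem mul_mono {s : Fin n → R} (hs : ∀ i j, s i * s j = -(s j * s i))
    (j : Fin n) (I : Finset (Fin n)) :
    s j * mono s I = if j ∈ I then 0 else belowSign j I • mono s (insert j I) := by
  have hsq : ∀ i, s i * s i = 0 := fun i => by
    have h := hs i i
    have h2 : (2 : ℝ) • (s i * s i) = 0 := by
      rw [two_smul]
      nth_rewrite 1 [h]
      exact neg_add_cancel _
    exact (smul_eq_zero_iff_right (two_ne_zero)).1 h2
  induction I using Finset.induction_on_min with
  | empty =>
    rw [if_neg (Finset.notMem_empty j), belowSign_eq_one (by simp), one_smul,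
      mono_insert (by simp)]
  | insert a I haI ih =>
    rcases lt_trichotomy j a with h | h | h
    · have hj : ∀ x ∈ insert a I, j < x := fun x hx => by
        rcases Finset.mem_insert.1 hx with rfl | hx
        · exact h
        · exact h.trans (haI x hx)
      rw [if_neg fun hj' => (hj j hj').false, belowSign_eq_one hj, one_smul, mono_insert hj]
    · subst h
      rw [if_pos (Finset.mem_insert_self _ _), mono_insert haI, ← mul_assoc, hsq, zero_mul]
    · have h1 : j ∈ insert a I ↔ j ∈ I := by
        rw [Finset.mem_insert, or_iff_right h.ne']
      rw [mono_insert haI, ← mul_assoc, hs, neg_mul, mul_assoc, ih]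
      by_cases hj : j ∈ I
      · rw [if_pos hj, if_pos (h1.2 hj), mul_zero, neg_zero]
      · have h2 : ∀ x ∈ insert j I, a < x := fun x hx => by
          rcases Finset.mem_insert.1 hx with rfl | hx
          · exact h
          · exact haI x hx
        rw [if_neg hj, if_neg (mt h1.1 hj), belowSign_insert fun ha => (haI a ha).false,
          if_pos h, Finset.insert_comm, mono_insert h2, mul_smul_comm, neg_one_mul, neg_smul]

/-- The rule `∂_j(s_i s_I) = δ_{ij} s_I - s_i ∂_j(s_I)`. -/
theorem monoDeriv_mul {s : Fin n → R} (hs : ∀ i j, s i * s j = -(s j * s i))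
    (i j : Fin n) (I : Finset (Fin n)) :
    (if i ∈ I then 0 else belowSign i I • monoDeriv s j (insert i I)) =
      (if i = j then mono s I else 0) - s i * monoDeriv s j I := by
  unfold monoDeriv
  by_cases hi : i ∈ I
  · rw [if_pos hi]
    by_cases hij : i = j
    · subst hij
      rw [if_pos hi, if_pos rfl, mul_smul_comm, mul_mono hs, if_neg (Finset.notMem_erase i I),
        belowSign_erase, smul_smul, belowSign_mul_self, one_smul, Finset.insert_erase hi, sub_self]
    · rw [if_neg hij, zero_sub]
      by_cases hj : j ∈ I
      · rw [if_pos hj, mul_smul_comm, mul_mono hs, if_pos (Finset.mem_erase.2 ⟨hij, hi⟩),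
          smul_zero, neg_zero]
      · rw [if_neg hj, mul_zero, neg_zero]
  · rw [if_neg hi]
    by_cases hij : i = j
    · subst hij
      rw [if_pos (Finset.mem_insert_self _ _), if_pos rfl, if_neg hi, mul_zero, sub_zero,
        Finset.erase_insert hi, ← belowSign_erase i (insert i I), Finset.erase_insert hi,
        smul_smul, belowSign_mul_self, one_smul]
    · have h1 : j ∈ insert i I ↔ j ∈ I := by
        rw [Finset.mem_insert, or_iff_right (Ne.symm hij)]
      rw [if_neg hij, zero_sub]
      by_cases hj : j ∈ I
      · have hi' : i ∉ I.erase j := fun h => hi (Finset.mem_of_mem_erase h)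
        have h2 : belowSign i I = (if j < i then -1 else 1) * belowSign i (I.erase j) := by
          rw [← belowSign_insert (Finset.notMem_erase j I), Finset.insert_erase hj]
        rw [if_pos (h1.2 hj), if_pos hj, mul_smul_comm, mul_mono hs, if_neg hi', smul_smul,
          smul_smul, Finset.erase_insert_of_ne hij, ← neg_smul, belowSign_insert hi, h2]
        congr 1
        -- Exactly one of the two position signs changes, according to the order of `i` and `j`;
        -- this is the overall minus sign.
        rcases lt_or_gt_of_ne hij with h | h
        · rw [if_pos h, if_neg h.asymm]
          ring
        · rw [if_pos h, if_neg h.asymm]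
          ring
      · rw [if_neg (mt h1.1 hj), if_neg hj, mul_zero, neg_zero, smul_zero]

theorem mono_mul_mono_mem_span {s : Fin n → R} (hs : ∀ i j, s i * s j = -(s j * s i))
    (I J : Finset (Fin n)) :
    mono s I * mono s J ∈ Submodule.span ℝ (Set.range (mono s)) := by
  induction I using Finset.induction_on_min with
  | empty =>
    rw [mono_empty, one_mul]
    exact Submodule.subset_span ⟨J, rfl⟩
  | insert a I haI ih =>
    rw [mono_insert haI, mul_assoc]
    generalize mono s I * mono s J = w at ih
    induction ih using Submodule.span_induction with
    | mem x hx =>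
      obtain ⟨K, rfl⟩ := hx
      rw [mul_mono hs]
      split_ifs
      · exact zero_mem _
      · exact Submodule.smul_mem _ _ (Submodule.subset_span ⟨_, rfl⟩)
    | zero => rw [mul_zero]; exact zero_mem _
    | add x y _ _ hx hy => rw [mul_add]; exact add_mem hx hy
    | smul r x _ hx => rw [mul_smul_comm]; exact Submodule.smul_mem _ _ hx

theorem map_mono {R' : Type*} [Ring R'] [Algebra ℝ R'] (φ : R →ₐ[ℝ] R') (s : Fin n → R)
    (I : Finset (Fin n)) : φ (mono s I) = mono (fun i => φ (s i)) I := by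
  rw [mono, map_list_prod, List.map_map]
  rfl

theorem map_monoDeriv {R' : Type*} [Ring R'] [Algebra ℝ R'] (φ : R →ₐ[ℝ] R') (s : Fin n → R)
    (j : Fin n) (I : Finset (Fin n)) :
    φ (monoDeriv s j I) = monoDeriv (fun i => φ (s i)) j I := by
  unfold monoDeriv
  split_ifs
  · rw [map_smul, map_mono]
  · exact map_zero φ

end Grassmann

theorem koszul_zero_left (i : ZMod 2) : koszul 0 i = 1 := by simp [koszul]

theorem koszul_one_one : koszul 1 1 = -1 := by simp [koszul, ZMod.val_one]

/-! ### Partial derivatives in a splitting. -/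

namespace SuperalgebraSheaf

variable {M : Type u} [TopologicalSpace M] {A : SuperalgebraSheaf M}
  {m n : ℕ} [ChartedSpace (EuclideanSpace ℝ (Fin m)) M] {U : Opens M}

namespace Splitting

/-- Restriction of a splitting to a smaller open set. -/
def restrict (S : A.Splitting (m := m) n U) {U' : Opens M} (h : U' ≤ U) :
    A.Splitting (m := m) n U' where
  emb V hV := S.emb V (hV.trans h)
  emb_res V W hV hW f := S.emb_res V W (hV.trans h) hW f
  emb_mem V hV f := S.emb_mem V (hV.trans h) f
  odd k := A.res h (S.odd k)
  odd_mem k := A.res_mem h (S.odd_mem k)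
  expansion V hV f := by
    simp only [res_res]
    exact S.expansion V (hV.trans h) f

variable (S : A.Splitting (m := m) n U) {V : Opens M} (hV : V ≤ U)

/-- The restrictions of the odd coordinates. -/
def odds (i : Fin n) : A.Sec V := A.res hV (S.odd i)

theorem odds_mem (i : Fin n) : S.odds hV i ∈ A.deg V 1 := A.res_mem hV (S.odd_mem i)

theorem res_odds {W : Opens M} (hW : W ≤ V) (i : Fin n) :
    A.res hW (S.odds hV i) = S.odds (hW.trans hV) i := A.res_res hV hW _

theorem odds_mul (i j : Fin n) : S.odds hV i * S.odds hV j = -(S.odds hV j * S.odds hV i) := by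
  rw [A.mul_comm V 1 1 _ _ (S.odds_mem hV i) (S.odds_mem hV j), koszul_one_one, neg_one_smul]

theorem emb_mul_comm (a : C^∞⟮𝓡 m, V; ℝ⟯) (f : A.Sec V) :
    S.emb V hV a * f = f * S.emb V hV a := by
  refine A.section_induction (p := fun f => S.emb V hV a * f = f * S.emb V hV a)
    (by rw [mul_zero, zero_mul]) (fun j f hf => ?_) (fun f g hf hg => ?_) f
  · rw [A.mul_comm V 0 j _ _ (S.emb_mem V hV a) hf, koszul_zero_left, one_smul]
  · rw [mul_add, hf, hg, add_mul]

theorem mono_mem (I : Finset (Fin n)) : mono (S.odds hV) I ∈ A.deg V (I.card : ZMod 2) := by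
  induction I using Finset.induction_on_min with
  | empty =>
    rw [mono_empty, Finset.card_empty, Nat.cast_zero]
    exact SetLike.one_mem_graded _
  | insert a I haI ih =>
    rw [mono_insert haI, Finset.card_insert_of_notMem fun h => (haI a h).false, Nat.cast_succ,
      add_comm]
    exact SetLike.mul_mem_graded (S.odds_mem hV a) ih

/-- The linear map from coefficients to sections. -/
noncomputable def assemble : (Finset (Fin n) → C^∞⟮𝓡 m, V; ℝ⟯) →ₗ[ℝ] A.Sec V where
  toFun c := ∑ I, S.emb V hV (c I) * mono (S.odds hV) I
  map_add' c c' := by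
    simp only [Pi.add_apply, map_add, add_mul, Finset.sum_add_distrib]
  map_smul' r c := by
    simp only [Pi.smul_apply, map_smul, smul_mul_assoc, Finset.smul_sum, RingHom.id_apply]

theorem bijective_assemble : Function.Bijective (S.assemble hV) := by
  refine ⟨fun c c' h => (S.expansion V hV (S.assemble hV c)).unique rfl h, fun f => ?_⟩
  obtain ⟨c, hc, -⟩ := S.expansion V hV f
  exact ⟨c, hc.symm⟩

/-- The coefficients `f_I` of a section `f = ∑_I f_I s_I`. -/
noncomputable def coef : A.Sec V ≃ₗ[ℝ] (Finset (Fin n) → C^∞⟮𝓡 m, V; ℝ⟯) :=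
  (LinearEquiv.ofBijective _ (S.bijective_assemble hV)).symm

theorem sum_coef (f : A.Sec V) :
    f = ∑ I, S.emb V hV (S.coef hV f I) * mono (S.odds hV) I :=
  ((LinearEquiv.ofBijective _ (S.bijective_assemble hV)).apply_symm_apply f).symm

theorem coef_assemble (c : Finset (Fin n) → C^∞⟮𝓡 m, V; ℝ⟯) :
    S.coef hV (S.assemble hV c) = c :=
  (LinearEquiv.ofBijective _ (S.bijective_assemble hV)).symm_apply_apply c

theorem coef_emb_mul_mono (a : C^∞⟮𝓡 m, V; ℝ⟯) (I : Finset (Fin n)) :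
    S.coef hV (S.emb V hV a * mono (S.odds hV) I) = Pi.single I a := by
  rw [← S.coef_assemble hV (Pi.single I a)]
  congr 1
  change _ = ∑ J, S.emb V hV (Pi.single (M := fun _ => C^∞⟮𝓡 m, V; ℝ⟯) I a J) *
    mono (S.odds hV) J
  rw [Finset.sum_eq_single I]
  · rw [Pi.single_eq_same]
  · intro J _ hJ
    rw [Pi.single_eq_of_ne hJ, map_zero, zero_mul]
  · intro h; exact absurd (Finset.mem_univ _) h

theorem coef_emb_mul (a : C^∞⟮𝓡 m, V; ℝ⟯) (f : A.Sec V) (I : Finset (Fin n)) :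
    S.coef hV (S.emb V hV a * f) I = a * S.coef hV f I := by
  have : S.emb V hV a * f = S.assemble hV fun I => a * S.coef hV f I := by
    conv_lhs => rw [S.sum_coef hV f, Finset.mul_sum]
    refine Finset.sum_congr rfl fun I _ => ?_
    rw [map_mul, mul_assoc]
  rw [this, coef_assemble]

theorem coef_res {W : Opens M} (hW : W ≤ V) (f : A.Sec V) (I : Finset (Fin n)) :
    S.coef (hW.trans hV) (A.res hW f) I = resSmooth hW (S.coef hV f I) := by
  have : A.res hW f = S.assemble (hW.trans hV) fun I => resSmooth hW (S.coef hV f I) := by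
    conv_lhs => rw [S.sum_coef hV f, map_sum]
    refine Finset.sum_congr rfl fun I _ => ?_
    rw [map_mul, S.emb_res V W hV hW, map_mono]
    simp only [S.res_odds hV hW]
  rw [this, coef_assemble]

theorem induction {p : A.Sec V → Prop} (h0 : p 0) (add : ∀ f g, p f → p g → p (f + g))
    (h : ∀ a I, p (S.emb V hV a * mono (S.odds hV) I)) (f : A.Sec V) : p f := by
  rw [S.sum_coef hV f]
  exact Finset.sum_induction _ p add h0 fun I _ => h _ _

/-- Each term `f_I s_I` is homogeneous of parity `|I|`, so projecting the expansion of `f` to parity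
`j` keeps or deletes it whole. -/
theorem homogeneous_induction {j : ZMod 2} {p : A.Sec V → Prop} (h0 : p 0)
    (add : ∀ f g, p f → p g → p (f + g))
    (h : ∀ a I, (I.card : ZMod 2) = j → p (S.emb V hV a * mono (S.odds hV) I)) {f : A.Sec V}
    (hf : f ∈ A.deg V j) : p f := by
  have h1 : f = ∑ I, A.proj V j (S.emb V hV (S.coef hV f I) * mono (S.odds hV) I) := by
    rw [← map_sum, ← S.sum_coef hV f, A.proj_of_mem hf, if_pos rfl]
  rw [h1]
  refine Finset.sum_induction _ p add h0 fun I _ => ?_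
  have h2 := SetLike.mul_mem_graded (S.emb_mem V hV (S.coef hV f I)) (S.mono_mem hV I)
  rw [zero_add] at h2
  rw [A.proj_of_mem h2]
  split_ifs with h3
  · exact h _ _ h3.symm
  · exact h0

/-- The operator `∑_I f_I s_I ↦ ∑_I L(f_I) δ_I`. -/
noncomputable def lift (L : C^∞⟮𝓡 m, V; ℝ⟯ →ₗ[ℝ] C^∞⟮𝓡 m, V; ℝ⟯)
    (δ : Finset (Fin n) → A.Sec V) : A.Sec V →ₗ[ℝ] A.Sec V where
  toFun f := ∑ I, S.emb V hV (L (S.coef hV f I)) * δ I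
  map_add' f g := by
    simp only [map_add, Pi.add_apply, add_mul, Finset.sum_add_distrib]
  map_smul' r f := by
    simp only [map_smul, Pi.smul_apply, smul_mul_assoc, Finset.smul_sum, RingHom.id_apply]

theorem lift_emb_mul_mono (L : C^∞⟮𝓡 m, V; ℝ⟯ →ₗ[ℝ] C^∞⟮𝓡 m, V; ℝ⟯)
    (δ : Finset (Fin n) → A.Sec V) (a : C^∞⟮𝓡 m, V; ℝ⟯) (I : Finset (Fin n)) :
    S.lift hV L δ (S.emb V hV a * mono (S.odds hV) I) = S.emb V hV (L a) * δ I := by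
  change ∑ J, S.emb V hV (L (S.coef hV _ J)) * δ J = _
  rw [coef_emb_mul_mono, Finset.sum_eq_single I]
  · rw [Pi.single_eq_same]
  · intro J _ hJ
    rw [Pi.single_eq_of_ne hJ, map_zero, map_zero, zero_mul]
  · intro h; exact absurd (Finset.mem_univ _) h

theorem res_lift {W : Opens M} (hW : W ≤ V) {L : C^∞⟮𝓡 m, V; ℝ⟯ →ₗ[ℝ] C^∞⟮𝓡 m, V; ℝ⟯}
    {L' : C^∞⟮𝓡 m, W; ℝ⟯ →ₗ[ℝ] C^∞⟮𝓡 m, W; ℝ⟯} (hL : ∀ a, resSmooth hW (L a) = L' (resSmooth hW a))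
    {δ : Finset (Fin n) → A.Sec V} {δ' : Finset (Fin n) → A.Sec W}
    (hδ : ∀ I, A.res hW (δ I) = δ' I) (f : A.Sec V) :
    A.res hW (S.lift hV L δ f) = S.lift (hW.trans hV) L' δ' (A.res hW f) := by
  change A.res hW (∑ I, S.emb V hV (L (S.coef hV f I)) * δ I) =
    ∑ I, S.emb W _ (L' (S.coef _ _ I)) * δ' I
  rw [map_sum]
  refine Finset.sum_congr rfl fun I _ => ?_
  rw [map_mul, S.emb_res V W hV hW, hδ, S.coef_res hV hW, ← hL]

/-- The operator `∂/∂s_j` on sections over `V`. -/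
noncomputable def oddPartial (j : Fin n) : A.Sec V →ₗ[ℝ] A.Sec V :=
  S.lift hV LinearMap.id (monoDeriv (S.odds hV) j)

theorem oddPartial_emb_mul (j : Fin n) (a : C^∞⟮𝓡 m, V; ℝ⟯) (g : A.Sec V) :
    S.oddPartial hV j (S.emb V hV a * g) = S.emb V hV a * S.oddPartial hV j g := by
  refine S.induction hV (p := fun g => S.oddPartial hV j (S.emb V hV a * g) =
    S.emb V hV a * S.oddPartial hV j g) ?_ (fun g g' hg hg' => ?_) (fun b I => ?_) g
  · simp only [mul_zero, map_zero]
  · rw [mul_add, map_add, hg, hg', map_add, mul_add]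
  · rw [← mul_assoc, ← map_mul, oddPartial, lift_emb_mul_mono, lift_emb_mul_mono, ← mul_assoc,
      LinearMap.id_apply, LinearMap.id_apply, map_mul]

theorem oddPartial_mono (j : Fin n) (I : Finset (Fin n)) :
    S.oddPartial hV j (mono (S.odds hV) I) = monoDeriv (S.odds hV) j I := by
  have h := S.lift_emb_mul_mono hV LinearMap.id (monoDeriv (S.odds hV) j) 1 I
  rwa [LinearMap.id_apply, map_one, one_mul, one_mul] at h

theorem oddPartial_odds_mul (i j : Fin n) (g : A.Sec V) : S.oddPartial hV j (S.odds hV i * g) =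
    (if i = j then g else 0) - S.odds hV i * S.oddPartial hV j g := by
  refine S.induction hV (p := fun g => S.oddPartial hV j (S.odds hV i * g) =
    (if i = j then g else 0) - S.odds hV i * S.oddPartial hV j g) ?_ (fun g g' hg hg' => ?_)
    (fun b I => ?_) g
  · simp only [mul_zero, map_zero, ite_self, sub_zero]
  · rw [mul_add, map_add, hg, hg', map_add, mul_add]
    split_ifs <;> abel
  · have h1 : S.odds hV i * (S.emb V hV b * mono (S.odds hV) I) =
        S.emb V hV b * (S.odds hV i * mono (S.odds hV) I) := by
      rw [← mul_assoc, ← emb_mul_comm, mul_assoc]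
    have h2 := monoDeriv_mul (S.odds_mul hV) i j I
    rw [h1, oddPartial_emb_mul, mul_mono (S.odds_mul hV), apply_ite (S.oddPartial hV j), map_zero,
      map_smul, oddPartial_mono, h2, mul_sub, oddPartial_emb_mul, oddPartial_mono, mul_ite,
      mul_zero, ← mul_assoc, ← mul_assoc, emb_mul_comm _ _ _ (S.odds hV i)]

/-- The Leibniz rule is built up one odd factor at a time; linearity over smooth functions then
extends it to all sections. -/
theorem oddPartial_mono_mul (j : Fin n) (I : Finset (Fin n)) (g : A.Sec V) :
    S.oddPartial hV j (mono (S.odds hV) I * g) = S.oddPartial hV j (mono (S.odds hV) I) * g +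
      koszul 1 I.card • (mono (S.odds hV) I * S.oddPartial hV j g) := by
  induction I using Finset.induction_on_min with
  | empty =>
    rw [oddPartial_mono, monoDeriv, if_neg (Finset.notMem_empty j), Finset.card_empty,
      Nat.cast_zero, koszul_zero_right, mono_empty, one_mul, one_mul, zero_mul, zero_add, one_smul]
  | insert a I haI ih =>
    rw [mono_insert haI, mul_assoc, oddPartial_odds_mul, oddPartial_odds_mul, ih, sub_mul,
      Finset.card_insert_of_notMem fun h => (haI a h).false, Nat.cast_succ, koszul_add_right,
      koszul_one_one, mul_neg_one, neg_smul, mul_add, mul_smul_comm, mul_assoc, mul_assoc, ite_mul,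
      zero_mul]
    abel

variable (n) in
/-- The odd vector field `∂/∂s_j`. -/
noncomputable def oddField (j : Fin n) : A.LocalOp U := ⟨fun _ hV => S.oddPartial hV j⟩

theorem oddField_mem (j : Fin n) : S.oddField n j ∈ A.homDer U 1 := by
  refine ⟨fun V W hV hW f => ?_, fun V hV k f hf => ?_, fun V hV k f g hf => ?_⟩
  · refine S.res_lift hV hW (fun a => rfl) (fun I => ?_) f
    rw [map_monoDeriv]
    simp only [S.res_odds hV hW]
  · refine S.homogeneous_induction hV (p := fun f => S.oddPartial hV j f ∈ A.deg V (1 + k))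
      (by rw [map_zero]; exact zero_mem _)
      (fun f g hf hg => by rw [map_add]; exact add_mem hf hg) (fun a I hI => ?_) hf
    rw [oddPartial_emb_mul, oddPartial_mono, monoDeriv]
    split_ifs with h
    · have h1 := S.mono_mem hV (I.erase j)
      have h2 : ((I.erase j).card : ZMod 2) = 0 + (1 + k) := by
        rw [← hI, ← Finset.card_erase_add_one h, Nat.cast_succ, add_comm _ (1 : ZMod 2),
          ← add_assoc 1, CharTwo.add_self_eq_zero, zero_add, zero_add]
      rw [← zero_add (1 + k)]
      refine SetLike.mul_mem_graded (S.emb_mem V hV a) (Submodule.smul_mem _ _ ?_)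
      rwa [h2, zero_add] at h1
    · rw [mul_zero]
      exact zero_mem _
  · change S.oddPartial hV j (f * g) = S.oddPartial hV j f * g +
      koszul 1 k • (f * S.oddPartial hV j g)
    refine S.homogeneous_induction hV (p := fun f => S.oddPartial hV j (f * g) =
      S.oddPartial hV j f * g + koszul 1 k • (f * S.oddPartial hV j g))
      (by simp only [zero_mul, map_zero, smul_zero, add_zero])
      (fun f f' hf hf' => by
        rw [add_mul, map_add, hf, hf', map_add, add_mul, add_mul, smul_add]; abel)
      (fun a I hI => ?_) hf
    rw [mul_assoc, oddPartial_emb_mul, oddPartial_emb_mul, oddPartial_mono_mul, hI, mul_add,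
      mul_smul_comm, mul_assoc, mul_assoc]

variable [IsManifold (𝓡 m) ∞ M] {x₀ : M} (hU : U ≤ chartDomain m x₀)

/-- The operator `∂/∂x_i` on sections over `V`. -/
noncomputable def evenPartial (i : Fin m) : A.Sec V →ₗ[ℝ] A.Sec V :=
  S.lift hV (pderiv (hV.trans hU) i) (mono (S.odds hV))

/-- Real combinations of odd monomials act as constants for `∂/∂x_i`. Products of monomials are such
combinations, so the Leibniz rule reduces to smooth functions without computing their signs. -/
theorem evenPartial_emb_mul_of_mem_span (i : Fin m) (a : C^∞⟮𝓡 m, V; ℝ⟯) {w : A.Sec V}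
    (hw : w ∈ Submodule.span ℝ (Set.range (mono (S.odds hV)))) :
    S.evenPartial hV hU i (S.emb V hV a * w) = S.emb V hV (pderiv (hV.trans hU) i a) * w := by
  induction hw using Submodule.span_induction with
  | mem x hx =>
    obtain ⟨I, rfl⟩ := hx
    exact S.lift_emb_mul_mono hV _ _ a I
  | zero => rw [mul_zero, map_zero, mul_zero]
  | add x y _ _ hx hy => rw [mul_add, map_add, hx, hy, mul_add]
  | smul r x _ hx => rw [mul_smul_comm, map_smul, hx, mul_smul_comm]

theorem evenPartial_mul (i : Fin m) (f g : A.Sec V) : S.evenPartial hV hU i (f * g) =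
    S.evenPartial hV hU i f * g + f * S.evenPartial hV hU i g := by
  refine S.induction hV (p := fun f => S.evenPartial hV hU i (f * g) =
    S.evenPartial hV hU i f * g + f * S.evenPartial hV hU i g)
    (by simp only [zero_mul, map_zero, add_zero])
    (fun f f' hf hf' => by rw [add_mul, map_add, hf, hf', map_add, add_mul, add_mul]; abel)
    (fun a I => ?_) f
  refine S.induction hV
    (p := fun g => S.evenPartial hV hU i (S.emb V hV a * mono (S.odds hV) I * g) =
    S.evenPartial hV hU i (S.emb V hV a * mono (S.odds hV) I) * g +
      S.emb V hV a * mono (S.odds hV) I * S.evenPartial hV hU i g)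
    (by simp only [mul_zero, map_zero, add_zero])
    (fun g g' hg hg' => by rw [mul_add, map_add, hg, hg', map_add, mul_add, mul_add]; abel)
    (fun b J => ?_) g
  have h1 : ∀ a b, S.emb V hV a * mono (S.odds hV) I * (S.emb V hV b * mono (S.odds hV) J) =
      S.emb V hV (a * b) * (mono (S.odds hV) I * mono (S.odds hV) J) := fun a b => by
    rw [mul_assoc, ← mul_assoc (mono (S.odds hV) I), ← emb_mul_comm, mul_assoc, ← mul_assoc,
      map_mul]
  rw [h1, S.evenPartial_emb_mul_of_mem_span hV hU i _
    (mono_mul_mono_mem_span (S.odds_mul hV) I J),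
    S.evenPartial_emb_mul_of_mem_span hV hU i a (Submodule.subset_span ⟨I, rfl⟩),
    S.evenPartial_emb_mul_of_mem_span hV hU i b (Submodule.subset_span ⟨J, rfl⟩), h1, h1,
    pderiv_mul, map_add, add_mul]

/-- The even vector field `∂/∂x_i`. -/
noncomputable def evenField (i : Fin m) : A.LocalOp U := ⟨fun _ hV => S.evenPartial hV hU i⟩

theorem evenField_mem (i : Fin m) : S.evenField hU i ∈ A.homDer U 0 := by
  refine ⟨fun V W hV hW f => ?_, fun V hV k f hf => ?_, fun V hV k f g hf => ?_⟩
  · refine S.res_lift hV hW (fun a => resSmooth_pderiv (hV.trans hU) hW i a) (fun I => ?_) f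
    rw [map_mono]
    simp only [S.res_odds hV hW]
  · refine S.homogeneous_induction hV
      (p := fun f => S.evenPartial hV hU i f ∈ A.deg V (0 + k))
      (by rw [map_zero]; exact zero_mem _)
      (fun f g hf hg => by rw [map_add]; exact add_mem hf hg) (fun a I hI => ?_) hf
    rw [S.evenPartial_emb_mul_of_mem_span hV hU i a (Submodule.subset_span ⟨I, rfl⟩), ← hI]
    exact SetLike.mul_mem_graded (S.emb_mem V hV _) (S.mono_mem hV I)
  · rw [koszul_zero_left, one_smul]
    exact S.evenPartial_mul hV hU i f g

end Splitting

end SuperalgebraSheaf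

/-! ### Coordinate vector fields form a frame. -/

namespace SuperalgebraSheaf

variable {M : Type u} [TopologicalSpace M] {A : SuperalgebraSheaf M}
  {m n : ℕ} [ChartedSpace (EuclideanSpace ℝ (Fin m)) M] [IsManifold (𝓡 m) ∞ M] {U : Opens M}

theorem homDer_one {i : ZMod 2} {D : A.LocalOp U} (hD : D ∈ A.homDer U i) {V : Opens M}
    (hV : V ≤ U) : D V hV 1 = 0 := by
  have h := hD.2.2 V hV 0 1 1 (SetLike.one_mem_graded _)
  rwa [one_mul, koszul_zero_right, one_smul, mul_one, one_mul, left_eq_add] at h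

theorem homDer_algebraMap {i : ZMod 2} {D : A.LocalOp U} (hD : D ∈ A.homDer U i) {V : Opens M}
    (hV : V ≤ U) (r : ℝ) : D V hV (algebraMap ℝ _ r) = 0 := by
  rw [Algebra.algebraMap_eq_smul_one, map_smul, homDer_one hD, smul_zero]

namespace Splitting

variable (S : A.Splitting (m := m) n U) {V : Opens M} (hV : V ≤ U) {x₀ : M}
  (hU : U ≤ chartDomain m x₀)

/-- The even and odd coordinates on `V`. -/
noncomputable def coords : Fin m ⊕ Fin n → A.Sec V :=
  Sum.elim (fun k => S.emb V hV (coord (hV.trans hU) k)) (S.odds hV)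

theorem coords_mem (l : Fin m ⊕ Fin n) : S.coords hV hU l ∈ A.deg V (frameParity l) := by
  rcases l with k | k
  · exact S.emb_mem V hV _
  · exact S.odds_mem hV k

theorem res_coords {W : Opens M} (hW : W ≤ V) (l : Fin m ⊕ Fin n) :
    A.res hW (S.coords hV hU l) = S.coords (hW.trans hV) hU l := by
  rcases l with k | k
  · exact S.emb_res V W hV hW _
  · exact S.res_odds hV hW k

/-- The coordinate vector fields. -/
noncomputable def coordFields : Fin m ⊕ Fin n → A.Der U :=
  Sum.elim (fun i => ⟨S.evenField hU i, Submodule.mem_iSup_of_mem 0 (S.evenField_mem hU i)⟩)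
    fun j => ⟨S.oddField n j, Submodule.mem_iSup_of_mem 1 (S.oddField_mem j)⟩

theorem coordFields_mem (k : Fin m ⊕ Fin n) :
    S.coordFields hU k ∈ A.derDeg U (frameParity k) := by
  rcases k with k | k
  · exact S.evenField_mem hU k
  · exact S.oddField_mem k

theorem act_coordFields (k l : Fin m ⊕ Fin n) :
    A.act (A.resDer hV (S.coordFields hU k)) (S.coords hV hU l) = if k = l then 1 else 0 := by
  have hspan : ∀ I, mono (S.odds hV) I ∈ Submodule.span ℝ (Set.range (mono (S.odds hV))) :=
    fun I => Submodule.subset_span ⟨I, rfl⟩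
  rcases k with k | k <;> rcases l with l | l
  · change S.evenPartial hV hU k (S.emb V hV (coord (hV.trans hU) l)) = _
    have h := S.evenPartial_emb_mul_of_mem_span hV hU k (coord (hV.trans hU) l) (hspan ∅)
    rw [mono_empty, mul_one, mul_one, pderiv_coord] at h
    rw [h, apply_ite (S.emb V hV), map_one, map_zero]
    simp only [Sum.inl.injEq]
  · change S.evenPartial hV hU k (S.odds hV l) = _
    have h := S.evenPartial_emb_mul_of_mem_span hV hU k 1 (hspan {l})
    have h1 := pderiv_mul (hV.trans hU) k 1 1
    rw [one_mul, mul_one, one_mul, left_eq_add] at h1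
    rw [map_one, one_mul, mono_singleton, h1, map_zero, zero_mul] at h
    rw [h, if_neg Sum.inl_ne_inr]
  · change S.oddPartial hV k (S.emb V hV (coord (hV.trans hU) l)) = _
    have h := S.lift_emb_mul_mono hV LinearMap.id (monoDeriv (S.odds hV) k)
      (coord (hV.trans hU) l) ∅
    rw [mono_empty, mul_one, monoDeriv, if_neg (Finset.notMem_empty k), mul_zero] at h
    rw [if_neg Sum.inr_ne_inl]
    exact h
  · change S.oddPartial hV k (S.odds hV l) = _
    rw [← mono_singleton (S.odds hV) l, oddPartial_mono, monoDeriv]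
    simp only [Finset.mem_singleton, Sum.inr.injEq]
    split_ifs with h
    · subst h
      rw [← belowSign_erase, Finset.erase_singleton, mono_empty, belowSign_eq_one (by simp),
        one_smul]
    · rfl

/-- A homogeneous derivation that kills the coordinates is zero. -/
theorem homDer_eq_zero {i : ZMod 2} {D : A.LocalOp V} (hD : D ∈ A.homDer V i)
    (h : ∀ l, D V le_rfl (S.coords hV hU l) = 0) : D = 0 := by
  have h' : ∀ (W : Opens M) (hW : W ≤ V) l, D W hW (S.coords (hW.trans hV) hU l) = 0 :=
    fun W hW l => by rw [← S.res_coords hV hU hW, ← hD.1 V W le_rfl hW, h, map_zero]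
  have hmono : ∀ (W : Opens M) (hW : W ≤ V) (I : Finset (Fin n)),
      D W hW (mono (S.odds (hW.trans hV)) I) = 0 := fun W hW I => by
    induction I using Finset.induction_on_min with
    | empty => rw [mono_empty, homDer_one hD]
    | insert a I haI ih =>
      have h1 : D W hW (S.odds (hW.trans hV) a) = 0 := h' W hW (Sum.inr a)
      rw [mono_insert haI, hD.2.2 W hW 1 _ _ (S.odds_mem _ a), ih, h1, zero_mul, mul_zero,
        smul_zero, add_zero]
  have hmul : ∀ (W : Opens M) (hW : W ≤ V) (a : C^∞⟮𝓡 m, W; ℝ⟯) (g : A.Sec W),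
      D W hW (S.emb W (hW.trans hV) a * g) = D W hW (S.emb W (hW.trans hV) a) * g +
        S.emb W (hW.trans hV) a * D W hW g := fun W hW a g => by
    rw [hD.2.2 W hW 0 _ _ (S.emb_mem _ _ a), koszul_zero_right, one_smul]
  have hemb : ∀ (W : Opens M) (hW : W ≤ V) (a : C^∞⟮𝓡 m, W; ℝ⟯),
      D W hW (S.emb W (hW.trans hV) a) = 0 := fun W hW a => by
    -- `D` may send a smooth function to a section with any `s_I`-components, so every coefficient
    -- is tested at every point.
    refine (S.coef (hW.trans hV)).map_eq_zero_iff.1 ?_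
    funext I
    ext x
    obtain ⟨W', hW', hx, r, g, hr, hg⟩ := exists_hadamard_chart ((hW.trans hV).trans hU) a x
    -- By Hadamard and `D(x_k) = 0`, `D(a) = ∑ (x_k - r_k) D(g_k)` near `x`. Taking coefficients is
    -- linear over smooth functions, and `x_k - r_k` vanishes at `x`.
    have h1 : A.res hW' (D W hW (S.emb W (hW.trans hV) a)) =
        ∑ k, S.emb W' (hW'.trans (hW.trans hV)) (coord (hW'.trans ((hW.trans hV).trans hU)) k -
          algebraMap ℝ _ (r k)) *
          D W' (hW'.trans hW) (S.emb W' (hW'.trans (hW.trans hV)) (g k)) := by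
      have h2 := S.emb_res W W' (hW.trans hV) hW' a
      change _ = S.emb W' (hW'.trans (hW.trans hV)) (resSmooth hW' a) at h2
      rw [hD.1 W W' hW hW', h2, hg, map_add, map_add, AlgHom.commutes, homDer_algebraMap hD,
        zero_add, map_sum, map_sum]
      refine Finset.sum_congr rfl fun k _ => ?_
      have h3 : D W' (hW'.trans hW) (S.emb W' (hW'.trans (hW.trans hV))
          (coord (hW'.trans ((hW.trans hV).trans hU)) k)) = 0 := h' W' (hW'.trans hW) (Sum.inl k)
      rw [map_mul, hmul W' (hW'.trans hW), map_sub, map_sub, AlgHom.commutes,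
        homDer_algebraMap hD, h3, sub_zero, zero_mul, zero_add]
    have h2 := congrArg (fun c => c ⟨x.1, hx⟩) (S.coef_res (hW.trans hV) hW'
      (D W hW (S.emb W (hW.trans hV) a)) I)
    refine h2.symm.trans ?_
    rw [h1, map_sum, Finset.sum_apply]
    have h3 : ∀ F : Fin m → C^∞⟮𝓡 m, W'; ℝ⟯, (∑ k, F k) ⟨x.1, hx⟩ = ∑ k, F k ⟨x.1, hx⟩ :=
      fun F => map_sum
        ((Pi.evalRingHom (fun _ : W' => ℝ) ⟨x.1, hx⟩).comp ContMDiffMap.coeFnRingHom) F _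
    rw [h3]
    refine Finset.sum_eq_zero fun k _ => ?_
    rw [coef_emb_mul]
    change (coord _ k ⟨x.1, hx⟩ - r k) * _ = 0
    rw [hr, sub_self, zero_mul]
  refine LocalOp.ext fun W hW f => ?_
  refine S.induction (hW.trans hV) (p := fun f => D W hW f = 0) (map_zero _)
    (fun f g hf hg => by rw [map_add, hf, hg, add_zero]) (fun a I => ?_) f
  rw [hmul, hemb, hmono, zero_mul, mul_zero, add_zero]

/-- The coordinate vector fields form a frame. -/
theorem isFrame_coordFields : A.IsFrame U (S.coordFields hU) where
  mem := S.coordFields_mem hU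
  basis W hW E := by
    -- Duality with the coordinates recovers the coefficients: it proves uniqueness and dictates the
    -- witness `c_l = E(x_l)`.
    have hact : ∀ (c : Fin m ⊕ Fin n → A.Sec W) (l : Fin m ⊕ Fin n),
        A.act (∑ k, c k • A.resDer hW (S.coordFields hU k)) (S.coords hW hU l) = c l :=
      fun c l => by
        rw [act_sum_smul]
        simp only [act_coordFields, mul_ite, mul_one, mul_zero, Finset.sum_ite_eq',
          Finset.mem_univ, if_true]
    refine existsUnique_of_exists_of_unique ?_ fun c c' hc hc' => ?_
    · refine der_induction (p := fun E => ∃ c : Fin m ⊕ Fin n → A.Sec W,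
        E = ∑ k, c k • A.resDer hW (S.coordFields hU k)) (fun i D hD => ?_)
        (fun D D' ⟨c, hc⟩ ⟨c', hc'⟩ => ⟨c + c', ?_⟩) E
      · refine ⟨fun l => A.act D (S.coords hW hU l), sub_eq_zero.1 (Subtype.ext ?_)⟩
        refine S.homDer_eq_zero hW hU (i := i) ?_ fun l => ?_
        · change _ - _ ∈ A.derDeg W i
          refine sub_mem hD (sum_mem fun k _ => ?_)
          have h := smul_mem_derDeg (act_mem hD (S.coords_mem hW hU k))
            (A.resDer_mem hW (S.coordFields_mem hU k))
          rwa [add_assoc, CharTwo.add_self_eq_zero, add_zero] at h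
        · change (D.1 - _) W le_rfl _ = 0
          rw [sub_apply]
          exact sub_eq_zero.2 (hact (fun l => A.act D (S.coords hW hU l)) l).symm
      · rw [hc, hc', ← Finset.sum_add_distrib]
        simp only [Pi.add_apply, add_smul]
    · funext l
      rw [← hact c l, ← hc, hc', hact]

end Splitting

theorem IsSupermanifold.hasLocalFrames (hA : A.IsSupermanifold m n) : A.HasLocalFrames m n := by
  intro x
  obtain ⟨U, hx, ⟨S⟩⟩ := hA x
  exact ⟨U ⊓ chartDomain m x, ⟨hx, mem_chart_source _ x⟩, _,
    (S.restrict inf_le_left).isFrame_coordFields inf_le_right⟩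

end SuperalgebraSheaf

end Supergeometry

theorem mainTheorem9 {m n : ℕ} {M : Type u} [TopologicalSpace M]
    [ChartedSpace (EuclideanSpace ℝ (Fin m)) M] [IsManifold (𝓡 m) ∞ M]
    (A : Supergeometry.SuperalgebraSheaf M) (hA : A.IsSupermanifold m n)
    (C : A.LinearConnection) :
    (∀ (U : Opens M) (i : ZMod 2) (D : A.Der U), D ∈ A.derDeg U i →
      Supergeometry.SuperalgebraSheaf.IsModuleEnd i (C.subAd D)) ∧
    (∀ (U : Opens M) (D : A.Der U),
      ∃! g : A.Sec U, Supergeometry.SuperalgebraSheaf.IsSupertrace (C.subAd D) g) ∧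
    A.IsDivergenceOperator C.div :=
  ⟨fun _ _ _ hD => C.isModuleEnd_subAd hD,
    -- Existence and uniqueness together ensure that the default value in `sTr` never enters `div`.
    fun _ D => ⟨_, C.isSupertrace_div hA.hasLocalFrames D,
      fun _ hg => hg.unique hA.hasLocalFrames (C.isSupertrace_div hA.hasLocalFrames D)⟩,
    C.isDivergenceOperator_div hA.hasLocalFrames⟩
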